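/- **Setting.** Let $k\ge 3$. The random $k$-SAT formula with $n$ Boolean variables and parameter $d\ge0$ consists of a $\mathrm{Po}(dn/k)$ number of independent clauses, each containing an ordered family of $k$ distinct variables, chosen uniformly at random, with independent uniformly random signs in $\{\pm1\}$. Let $d_{\mathrm{SAT}}(k)$ be the satisfiability threshold, i.e. the supremum of all $d\ge0$ such that the probability that this formula is satisfiable tends to $1$ as $n\to\infty$. Let $T$ be the two-type Galton–Watson tree that starts from a single variable $x_0$, in which every variable has an independent $\mathrm{Po}(d)$ number of child clauses and every clause has exactly $k-1$ child variables. For each adjacent clause/variable pair $(a,x)$ choose independently a uniformly random sign $J_{ax}\in\{\pm1\}$. Let $\partial v$ be the set of neighbours of $v$; an assignment $\sigma\in\{\pm1\}^{\partial a}$ satisfies $a$ (written $\sigma\models a$) if $J_{ay}\sigma_y=1$ for some $y\in\partial a$. Given a probability measure $\pi$ on $[0,1]$ and $\beta>0$, for all adjacent $a,x$ draw $\mu_{\pi,x\to a,0}(1)$ and $\mu_{\pi,a\to x,0}(1)$ independently from $\pi$ (independently of $T$ and the signs), and set $\mu_{\pi,\cdot,0}(-1)=1-\mu_{\pi,\cdot,0}(1)$.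 For $t\ge0$ and $s=\pm1$ define the Belief Propagation messages and root marginal $$\mu_{\pi,a\to x,t+1}(s)\propto\sum_{\sigma\in\{\pm1\}^{\partial a}}\mathbf 1\{\sigma_x=s\}\,e^{-\beta\mathbf 1\{\sigma\not\models a\}}\prod_{y\in\partial a\setminus\{x\}}\mu_{\pi,y\to a,t}(\sigma_y),$$ $$\mu_{\pi,x\to a,t+1}(s)\propto\prod_{b\in\partial x\setminus\{a\}}\mu_{\pi,b\to x,t+1}(s),\qquad \mu_{\pi,x_0,t+1}(s)\propto\prod_{b\in\partial x_0}\mu_{\pi,b\to x_0,t+1}(s),$$ each normalised so that the values at $s=1$ and $s=-1$ sum to $1$. Write $\pi_0=\delta_{1/2}$ (all initial messages equal $1/2$). The marginals for $\pi$ and for $\pi_0$ are compared on the same signed tree $T$. A probability measure $\pi$ on $[0,1]$ has *slim tails* if $$\pi\left(\left[0,\tfrac12-2^{-k/10}\right]\cup\left[\tfrac12+2^{-k/10},1\right]\right)\le 2^{-k/10}.$$ **Proposition.** There is an absolute constant $k_0\ge3$ such that for all integers $k\ge k_0$, all real $0<d\le d_{\mathrm{SAT}}(k)$ and all real $\beta\ge1$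 the following holds. 1. Uniformly for all $\pi$ with slim tails, $$\lim_{t\to\infty}\mathbb E\left|\mu_{\pi,x_0,t}(1)-\mu_{\pi_0,x_0,t}(1)\right|=0,$$ that is, for every $\varepsilon>0$ there is $t_0=t_0(k,d,\beta,\varepsilon)$ such that the expectation is at most $\varepsilon$ for all $t\ge t_0$ and all $\pi$ with slim tails. 2. The sequence $(\mu_{\pi_0,x_0,t}(1))_{t\ge1}$ converges weakly (in distribution) to a probability measure $\pi^\star_{d,\beta}$ on $[0,1]$ that has slim tails. -/

import Mathlib

open MeasureTheory ProbabilityTheory Filter Topology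

noncomputable section

namespace BPkSAT

/-! ### The random `k`-SAT formula and the satisfiability threshold

Truth values are Booleans, with `true` for `+1` and `false` for `-1`; likewise for the signs
with which variables occur in clauses. -/

/-- A `k`-clause over the variables `x₀, …, xₙ₋₁`: an ordered family of `k` distinct variables
together with their `k` signs. -/
abbrev KClause (k n : ℕ) : Type := (Fin k ↪ Fin n) × (Fin k → Bool)

/-- `σ ⊨ c`: some literal of the clause `c` is true under the assignment `σ`. -/
def KClause.SatisfiedBy {k n : ℕ} (c : KClause k n) (σ : Fin n → Bool) : Prop :=
  ∃ j, σ (c.1 j) = c.2 j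

/-- The probability that `m` independent uniformly random `k`-clauses over `n` variables are
simultaneously satisfiable. -/
def satFraction (k n m : ℕ) : ℝ :=
  (Nat.card {Φ : Fin m → KClause k n // ∃ σ : Fin n → Bool, ∀ i, (Φ i).SatisfiedBy σ} : ℝ) /
    (Nat.card (Fin m → KClause k n) : ℝ)

/-- The probability that the random `k`-SAT formula with `n` variables and a `Po(dn/k)` number
of clauses is satisfiable. -/
def satProb (k : ℕ) (d : ℝ) (n : ℕ) : ℝ :=
  ∫ m, satFraction k n m ∂(poissonMeasure (d * n / k).toNNReal)

/-- The satisfiability threshold `d_SAT(k)`: the supremum of all `d` for which the random `k`-SAT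
formula is satisfiable asymptotically almost surely. -/
def satThreshold (k : ℕ) : ℝ :=
  sSup {d : ℝ | 0 ≤ d ∧ Tendsto (fun n => satProb k d n) atTop (𝓝 1)}

/-! ### Belief Propagation on a locally finite formula -/

/-- A (possibly infinite, locally finite) Boolean formula in conjunctive normal form, given by its
factor graph: `vars a` is the neighbourhood `∂a` of a clause, `clauses x` is the neighbourhood `∂x`
of a variable, and `sign a x` is the sign of `x` in `a` (relevant for adjacent pairs only). -/
structure Formula (V C : Type) where
  vars : C → Finset V
  clauses : V → Finset C
  mem_clauses_iff : ∀ x a, a ∈ clauses x ↔ x ∈ vars a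
  sign : C → V → Bool

/-- Messages in both directions along the edges of the factor graph; values at non-adjacent pairs
are irrelevant. -/
structure Messages (V C : Type) where
  toVar : C → V → Bool → ℝ
  toClause : V → C → Bool → ℝ

/-- Normalise a weight on `{±1}` to total mass one. -/
def normalise (w : Bool → ℝ) (s : Bool) : ℝ := w s / (w true + w false)

/-- The message values `μ(1) = p`, `μ(-1) = 1 - p`. -/
def bernoulliMsg (p : ℝ) (s : Bool) : ℝ := if s then p else 1 - p

namespace Formula

variable {V C : Type} [DecidableEq V] [DecidableEq C]

/-- `σ ⊨ a` for an assignment `σ` of the variables in `∂a`. -/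
def Satisfies (F : Formula V C) (a : C) (σ : F.vars a → Bool) : Prop :=
  ∃ y : F.vars a, σ y = F.sign a y

instance (F : Formula V C) (a : C) (σ : F.vars a → Bool) : Decidable (F.Satisfies a σ) := by
  unfold Satisfies; infer_instance

/-- The clause-to-variable update
`μ_{a → x}(s) ∝ ∑_σ 1{σ_x = s} exp(-β 1{σ ⊭ a}) ∏_{y ∈ ∂a ∖ x} μ_{y → a}(σ_y)`,
where `σ` ranges over `{±1}^{∂a}`. -/
def clauseUpdate (F : Formula V C) (β : ℝ) (ν : V → C → Bool → ℝ) (a : C) (x : V) : Bool → ℝ :=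
  normalise fun s =>
    ∑ σ : F.vars a → Bool,
      (if ∀ y : F.vars a, (y : V) = x → σ y = s then 1 else 0) *
        Real.exp (-β * (if F.Satisfies a σ then 0 else 1)) *
        ∏ y ∈ Finset.univ.filter (fun y : F.vars a => (y : V) ≠ x), ν y a (σ y)

/-- The variable-to-clause update `μ_{x → a}(s) ∝ ∏_{b ∈ ∂x ∖ a} μ_{b → x}(s)`. -/
def varUpdate (F : Formula V C) (ν : C → V → Bool → ℝ) (x : V) (a : C) : Bool → ℝ :=
  normalise fun s => ∏ b ∈ (F.clauses x).erase a, ν b x s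

/-- One round of Belief Propagation: first all clause-to-variable messages are updated, then all
variable-to-clause messages are recomputed from them. -/
def bpRound (F : Formula V C) (β : ℝ) (m : Messages V C) : Messages V C where
  toVar := F.clauseUpdate β m.toClause
  toClause := F.varUpdate (F.clauseUpdate β m.toClause)

/-- The messages after `t` rounds. -/
def bp (F : Formula V C) (β : ℝ) (init : Messages V C) : ℕ → Messages V C
  | 0 => init
  | t + 1 => F.bpRound β (F.bp β init t)

/-- The Belief Propagation estimate of the marginal of `x` after `t` rounds,
`μ_{x,t}(s) ∝ ∏_{b ∈ ∂x} μ_{b → x,t}(s)`. -/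
def bpMarginal (F : Formula V C) (β : ℝ) (init : Messages V C) (t : ℕ) (x : V) : Bool → ℝ :=
  normalise fun s => ∏ b ∈ F.clauses x, (F.bp β init t).toVar b x s

end Formula

/-! ### The Galton–Watson `k`-SAT tree

Vertices have Ulam–Harris addresses. The root variable is `[]`; the `i`-th child clause of the
variable `x` is `(x, i)`; the `j`-th child variable of the clause `(x, i)` is `(i, j) :: x`. -/

/-- Addresses of variables. -/
abbrev TVar (k : ℕ) : Type := List (ℕ × Fin (k - 1))

/-- Addresses of clauses. -/
abbrev TClause (k : ℕ) : Type := TVar k × ℕ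

/-- The randomness of the tree: the number of child clauses of each variable and the sign of each
clause/variable pair. -/
abbrev TreeData (k : ℕ) : Type := (TVar k → ℕ) × (TClause k × TVar k → Bool)

/-- The variables in the clause `(x, i)`, which is present iff `i` is less than the number of
child clauses of `x`: the parent `x` and the `k - 1` children. -/
def treeVars {k : ℕ} (N : TVar k → ℕ) (a : TClause k) : Finset (TVar k) :=
  if a.2 < N a.1 then insert a.1 (Finset.univ.image fun j : Fin (k - 1) => (a.2, j) :: a.1) else ∅

/-- The parent clause of a variable (none for the root). -/
def treeParent {k : ℕ} (N : TVar k → ℕ) : TVar k → Finset (TClause k)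
  | [] => ∅
  | (i, _) :: y => if i < N y then {(y, i)} else ∅

/-- The clauses adjacent to a variable: its child clauses and its parent clause. -/
def treeClauses {k : ℕ} (N : TVar k → ℕ) (x : TVar k) : Finset (TClause k) :=
  (Finset.range (N x)).image (fun i => (x, i)) ∪ treeParent N x

theorem mem_treeClauses_iff {k : ℕ} (N : TVar k → ℕ) (x : TVar k) (a : TClause k) :
    a ∈ treeClauses N x ↔ x ∈ treeVars N a := by
  obtain ⟨y, i⟩ := a
  have hp : (y, i) ∈ treeParent N x ↔ i < N y ∧ ∃ j, (i, j) :: y = x := by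
    rcases x with _ | ⟨⟨i', j'⟩, z⟩
    · simp [treeParent]
    · simp only [treeParent, List.cons.injEq, Prod.mk.injEq]
      split_ifs with h
      · simp only [Finset.mem_singleton, Prod.mk.injEq]
        constructor
        · rintro ⟨rfl, rfl⟩
          exact ⟨h, j', ⟨rfl, rfl⟩, rfl⟩
        · rintro ⟨-, j, ⟨rfl, -⟩, rfl⟩
          exact ⟨rfl, rfl⟩
      · simp only [Finset.notMem_empty, false_iff]
        rintro ⟨h', j, ⟨rfl, -⟩, rfl⟩
        exact h h'
  have hc : (y, i) ∈ (Finset.range (N x)).image (fun i => ((x, i) : TClause k)) ↔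
      i < N y ∧ x = y := by
    simp only [Finset.mem_image, Finset.mem_range, Prod.mk.injEq]
    constructor
    · rintro ⟨i', h, rfl, rfl⟩
      exact ⟨h, rfl⟩
    · rintro ⟨h, rfl⟩
      exact ⟨i, h, rfl, rfl⟩
  rw [treeClauses, Finset.mem_union, hp, hc, treeVars, ← and_or_left]
  by_cases h : i < N y <;> simp [h]

/-- The `k`-SAT formula encoded by the data. The Galton–Watson tree is the connected component of
the root `[]` of its factor graph; the other components have no influence on the root. -/
def treeFormula {k : ℕ} (τ : TreeData k) : Formula (TVar k) (TClause k) where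
  vars := treeVars τ.1
  clauses := treeClauses τ.1
  mem_clauses_iff := mem_treeClauses_iff τ.1
  sign a x := τ.2 (a, x)

/-- The law of the tree: every variable has `Po(d)` child clauses and every sign is uniform on
`{±1}`, all independent. -/
def treeLaw (k : ℕ) (d : ℝ) : Measure (TreeData k) :=
  (Measure.infinitePi fun _ : TVar k => poissonMeasure d.toNNReal).prod
    (Measure.infinitePi fun _ : TClause k × TVar k => (PMF.uniformOfFintype Bool).toMeasure)

instance (k : ℕ) (d : ℝ) : IsProbabilityMeasure (treeLaw k d) := by
  unfold treeLaw; infer_instance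

/-- The probabilities assigned to `+1` by the initial messages, for both directions of each
clause/variable pair. -/
abbrev InitData (k : ℕ) : Type := (TClause k × TVar k → unitInterval) × (TVar k × TClause k → unitInterval)

/-- The law of initial messages drawn independently from `π`. -/
def initLaw (k : ℕ) (π : Measure unitInterval) [IsProbabilityMeasure π] : Measure (InitData k) :=
  (Measure.infinitePi fun _ : TClause k × TVar k => π).prod
    (Measure.infinitePi fun _ : TVar k × TClause k => π)

/-- The initial data drawn from the point mass at `1/2`: all messages are `1/2`. -/
def halfInit (k : ℕ) : InitData k :=
  (fun _ => ⟨1 / 2, by norm_num, by norm_num⟩, fun _ => ⟨1 / 2, by norm_num, by norm_num⟩)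

/-- Initial messages from initial data. -/
def initMessages {k : ℕ} (η : InitData k) : Messages (TVar k) (TClause k) where
  toVar a x := bernoulliMsg (η.1 (a, x))
  toClause x a := bernoulliMsg (η.2 (x, a))

/-- The Belief Propagation estimate `μ_{x₀,t}(1)` of the marginal of the root after `t` rounds. -/
def rootMarginal {k : ℕ} (β : ℝ) (τ : TreeData k) (η : InitData k) (t : ℕ) : ℝ :=
  (treeFormula τ).bpMarginal β (initMessages η) t [] true

/-- A probability measure on `[0,1]` has slim tails if it gives mass at most `2^(-k/10)` to
`[0, 1/2 - 2^(-k/10)] ∪ [1/2 + 2^(-k/10), 1]`. -/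
def SlimTails (k : ℕ) (π : Measure unitInterval) : Prop :=
  π {x : unitInterval | (x : ℝ) ∈ Set.Icc 0 (1 / 2 - (2 : ℝ) ^ (-(k : ℝ) / 10)) ∪
      Set.Icc (1 / 2 + (2 : ℝ) ^ (-(k : ℝ) / 10)) 1} ≤
    ENNReal.ofReal ((2 : ℝ) ^ (-(k : ℝ) / 10))

end BPkSAT

end

open BPkSAT

/-!
The messages from variables to their parent clauses are determined from the bottom up: in terms of
log-odds, `L_{t+1}(x) = ∑ ± f(∏_y q_y)`, where the sum is over the `Po(d)` child clauses of `x`, the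
signs are those of `x` in these clauses, `f(p) = -log(1 - (1 - e^{-β}) p)` (`clauseLog`), and `q_y`
is the probability, according to the messages at time `t`, that the literal of the child variable
`y` is false (`logOdds`, `upMsg`, `rootMarginal_succ`).

Since the signs at `x` are independent of everything below, the terms of this sum are orthogonal, so
second moments are at most `d` times those of a single term (`lintegral_sq_signed_sum_le`). A single
term is tiny: if the messages are within `δ = 2^{-k/10}` of `1/2` except with probability `δ`, then
`𝔼[q_y²]` is close to `1/4`, and independence of the subtrees bounds the second moment of
`∏_y q_y` by `0.3^{k-1}`. The first moment method gives `d ≤ k 2^k` up to the satisfiability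
threshold (`satThreshold_le`), and `k 2^k 0.3^k` is exponentially small.

* Slim tails are preserved (`measure_le_abs_logOdds_le`): Chebyshev's inequality applies to the sum
  once its terms are cut off at `1`, and with high probability no term is cut off. The cut-off makes
  the bound uniform in `β`.
* The mean squared difference of log-odds contracts (`lintegral_sq_logOdds_sub_le_mul`): changing
  the log-odds of one child by `Δ_y` changes `f(∏ q)` by at most `|Δ_y|` times the product of the
  other probabilities (`sq_clauseLog_prod_sub_le`), which gives the factor `d k² 0.3^{k-2} ≤ 1/2`.
  After one round the difference has finite second moment because `0 ≤ f ≤ β`.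

The first part of the theorem is this contraction applied to the two families of initial messages on
the same tree. For the second part it is applied to the messages started from `1/2` and the
same messages after one further round: the mean increments of the root marginal are summable, so it
converges almost surely on a single tree, hence in distribution.
-/

noncomputable section

namespace BPkSAT

open scoped ENNReal

/-! ### Log-odds and the contribution of a clause -/

/-- The log-likelihood ratio `-log (1 - (1 - e^{-β}) p)` that a clause contributes to one of its
variables, when `p` is the probability that none of the other variables satisfies the clause. -/
def clauseLog (β p : ℝ) : ℝ := -Real.log (1 - (1 - Real.exp (-β)) * p)

theorem clauseLog_nonneg {β p : ℝ} (hβ : 0 ≤ β) (h0 : 0 ≤ p) (h1 : p ≤ 1) :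
    0 ≤ clauseLog β p := by
  have he : Real.exp (-β) ≤ 1 := Real.exp_le_one_iff.2 (by linarith)
  have he' := Real.exp_pos (-β)
  rw [clauseLog, neg_nonneg]
  apply Real.log_nonpos <;> nlinarith

theorem clauseLog_le {β p : ℝ} (hβ : 0 ≤ β) (h1 : p ≤ 1) :
    clauseLog β p ≤ β := by
  have he : Real.exp (-β) ≤ 1 := Real.exp_le_one_iff.2 (by linarith)
  have he' := Real.exp_pos (-β)
  rw [clauseLog, neg_le, Real.le_log_iff_exp_le (by nlinarith)]
  nlinarith

/-- Cut off at `1`, the contribution of a clause is linear in `p`, uniformly in `β`. -/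
theorem min_clauseLog_one_le {β p : ℝ} (hβ : 0 ≤ β) (h0 : 0 ≤ p) :
    min (clauseLog β p) 1 ≤ 2 * p := by
  have he : Real.exp (-β) ≤ 1 := Real.exp_le_one_iff.2 (by linarith)
  have he' := Real.exp_pos (-β)
  rcases le_or_gt (1 / 2) p with h | h
  · exact (min_le_right _ _).trans (by linarith)
  · refine (min_le_left _ _).trans ?_
    set y := 1 - (1 - Real.exp (-β)) * p with hy
    have hy1 : 1 - p ≤ y := by nlinarith
    have hy0 : 0 < y := by linarith
    have h2 := Real.log_le_sub_one_of_pos (inv_pos.2 hy0)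
    rw [Real.log_inv] at h2
    refine h2.trans ?_
    have : y⁻¹ ≤ (1 - p)⁻¹ := inv_anti₀ (by linarith) hy1
    have h3 : (1 - p)⁻¹ ≤ 1 + 2 * p := by
      rw [inv_le_iff_one_le_mul₀ (by linarith)]
      nlinarith
    linarith

theorem abs_sigmoid_sub_le (x y : ℝ) : |Real.sigmoid x - Real.sigmoid y| ≤ 1 / 4 * |x - y| := by
  have := Convex.norm_image_sub_le_of_norm_hasDerivWithin_le (f := Real.sigmoid)
    (f' := fun x => Real.sigmoid x * (1 - Real.sigmoid x)) (C := 1 / 4) (s := Set.univ) (x := y)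
    (y := x) (fun z _ => (Real.hasDerivAt_sigmoid z).hasDerivWithinAt) (fun z _ => by
      have h1 := Real.sigmoid_pos z
      have h2 := Real.sigmoid_lt_one z
      rw [Real.norm_of_nonneg (by nlinarith)]
      nlinarith [sq_nonneg (Real.sigmoid z - 1 / 2)]) convex_univ trivial trivial
  simpa using this

/-- Changing a single log-odds: the contribution of a clause moves by at most `c` times as much,
uniformly in `c < 1`. -/
theorem abs_log_one_sub_mul_sigmoid_sub_le {c : ℝ} (h0 : 0 ≤ c) (h1 : c < 1) (x y : ℝ) :
    |Real.log (1 - c * Real.sigmoid x) - Real.log (1 - c * Real.sigmoid y)| ≤ c * |x - y| := by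
  have hpos : ∀ z, 0 < 1 - c * Real.sigmoid z := fun z => by
    nlinarith [Real.sigmoid_pos z, Real.sigmoid_lt_one z]
  have := Convex.norm_image_sub_le_of_norm_hasDerivWithin_le
    (f := fun z => Real.log (1 - c * Real.sigmoid z))
    (f' := fun z => -(c * (Real.sigmoid z * (1 - Real.sigmoid z))) / (1 - c * Real.sigmoid z))
    (C := c) (s := Set.univ) (x := y) (y := x)
    (fun z _ => (HasDerivAt.log (((Real.hasDerivAt_sigmoid z).const_mul c).const_sub 1)
      (hpos z).ne').hasDerivWithinAt) (fun z _ => by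
      have h1 := Real.sigmoid_pos z
      have h2 := Real.sigmoid_lt_one z
      rw [norm_div, norm_neg, Real.norm_of_nonneg (hpos z).le, Real.norm_of_nonneg
        (by apply mul_nonneg h0; nlinarith), div_le_iff₀ (hpos z)]
      apply mul_le_mul_of_nonneg_left _ h0
      nlinarith) convex_univ trivial trivial
  simpa using this

/-- Changing several log-odds, one at a time: each change is damped by the product of the other
probabilities. -/
theorem abs_log_one_sub_mul_prod_sub_le {ι : Type*} [DecidableEq ι] (s : Finset ι) (A B M : ι → ℝ)
    (hA : ∀ j, Real.sigmoid (A j) ≤ M j) (hB : ∀ j, Real.sigmoid (B j) ≤ M j)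
    {c : ℝ} (h0 : 0 ≤ c) (h1 : c < 1) :
    |Real.log (1 - c * ∏ j ∈ s, Real.sigmoid (A j)) -
      Real.log (1 - c * ∏ j ∈ s, Real.sigmoid (B j))| ≤
      c * ∑ j ∈ s, |A j - B j| * ∏ l ∈ s.erase j, M l := by
  have hM : ∀ j, 0 ≤ M j := fun j => (Real.sigmoid_nonneg _).trans (hA j)
  induction s using Finset.induction_on generalizing c with
  | empty => simp
  | insert i s hi ih =>
    have hsB : ∏ j ∈ s, Real.sigmoid (B j) ≤ ∏ j ∈ s, M j :=
      Finset.prod_le_prod (fun j _ => Real.sigmoid_nonneg _) fun j _ => hB j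
    have hsB0 : 0 ≤ ∏ j ∈ s, Real.sigmoid (B j) :=
      Finset.prod_nonneg fun j _ => Real.sigmoid_nonneg _
    have hsB1 : ∏ j ∈ s, Real.sigmoid (B j) ≤ 1 :=
      Finset.prod_le_one (fun j _ => Real.sigmoid_nonneg _) fun j _ => Real.sigmoid_le_one _
    have hiA := Real.sigmoid_pos (A i)
    have hiA1 := Real.sigmoid_lt_one (A i)
    have e1 := ih (c := c * Real.sigmoid (A i)) (by positivity) (by nlinarith)
    have e2 := abs_log_one_sub_mul_sigmoid_sub_le (c := c * ∏ j ∈ s, Real.sigmoid (B j))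
      (by positivity) (by nlinarith) (A i) (B i)
    rw [Finset.prod_insert hi, Finset.prod_insert hi, Finset.sum_insert hi,
      Finset.erase_insert hi]
    have hsum : ∑ j ∈ s, |A j - B j| * ∏ l ∈ (insert i s).erase j, M l =
        M i * ∑ j ∈ s, |A j - B j| * ∏ l ∈ s.erase j, M l := by
      rw [Finset.mul_sum]
      refine Finset.sum_congr rfl fun j hj => ?_
      have hij : i ≠ j := fun h => hi (h ▸ hj)
      rw [Finset.erase_insert_of_ne hij,
        Finset.prod_insert (fun h => hi (Finset.mem_of_mem_erase h))]
      ring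
    have hS : 0 ≤ ∑ j ∈ s, |A j - B j| * ∏ l ∈ s.erase j, M l :=
      Finset.sum_nonneg fun j _ => mul_nonneg (abs_nonneg _) (Finset.prod_nonneg fun l _ => hM l)
    rw [hsum]
    rw [← mul_assoc, ← mul_assoc]
    have e3 : c * (∏ j ∈ s, Real.sigmoid (B j)) * Real.sigmoid (A i) =
      c * Real.sigmoid (A i) * ∏ j ∈ s, Real.sigmoid (B j) := by ring
    have e4 : c * (∏ j ∈ s, Real.sigmoid (B j)) * Real.sigmoid (B i) =
      c * Real.sigmoid (B i) * ∏ j ∈ s, Real.sigmoid (B j) := by ring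
    rw [e3, e4] at e2
    calc _ ≤ _ := abs_sub_le _ (Real.log (1 - c * Real.sigmoid (A i) *
            ∏ j ∈ s, Real.sigmoid (B j))) _
      _ ≤ c * Real.sigmoid (A i) * ∑ j ∈ s, |A j - B j| * ∏ l ∈ s.erase j, M l +
          c * (∏ j ∈ s, Real.sigmoid (B j)) * |A i - B i| := add_le_add e1 e2
      _ ≤ c * M i * ∑ j ∈ s, |A j - B j| * ∏ l ∈ s.erase j, M l +
          c * (∏ j ∈ s, M j) * |A i - B i| := by
        gcongr
        exact hA i
      _ = _ := by ring

theorem sq_clauseLog_prod_sub_le {ι : Type*} [Fintype ι] [DecidableEq ι] (A B M : ι → ℝ)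
    (hA : ∀ j, Real.sigmoid (A j) ≤ M j) (hB : ∀ j, Real.sigmoid (B j) ≤ M j)
    {β : ℝ} (hβ : 0 ≤ β) :
    (clauseLog β (∏ j, Real.sigmoid (A j)) - clauseLog β (∏ j, Real.sigmoid (B j))) ^ 2 ≤
      Fintype.card ι * ∑ j, (A j - B j) ^ 2 * ∏ l ∈ Finset.univ.erase j, M l ^ 2 := by
  have hM : ∀ j, 0 ≤ M j := fun j => (Real.sigmoid_nonneg _).trans (hA j)
  have he : Real.exp (-β) ≤ 1 := Real.exp_le_one_iff.2 (by linarith)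
  have he' := Real.exp_pos (-β)
  have key := abs_log_one_sub_mul_prod_sub_le Finset.univ A B M hA hB
    (c := 1 - Real.exp (-β)) (by linarith) (by linarith)
  have hS : 0 ≤ ∑ j, |A j - B j| * ∏ l ∈ Finset.univ.erase j, M l :=
    Finset.sum_nonneg fun j _ => mul_nonneg (abs_nonneg _) (Finset.prod_nonneg fun l _ => hM l)
  have key2 : |clauseLog β (∏ j, Real.sigmoid (A j)) - clauseLog β (∏ j, Real.sigmoid (B j))| ≤
      ∑ j, |A j - B j| * ∏ l ∈ Finset.univ.erase j, M l := by
    rw [clauseLog, clauseLog, neg_sub_neg, abs_sub_comm]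
    refine key.trans ?_
    nlinarith
  rw [← sq_abs]
  calc _ ≤ (∑ j, |A j - B j| * ∏ l ∈ Finset.univ.erase j, M l) ^ 2 := by gcongr
    _ ≤ _ := sq_sum_le_card_mul_sum_sq
    _ = _ := by
      simp only [mul_pow, sq_abs, Finset.prod_pow, Finset.card_univ]

/-- The probability that the literal of sign `s` of a variable is false, when the variable takes
the value `+1` with probability `u`. -/
def oppProb (s : Bool) (u : ℝ) : ℝ := if s then 1 - u else u

theorem oppProb_nonneg {s : Bool} {u : ℝ} (h0 : 0 ≤ u) (h1 : u ≤ 1) : 0 ≤ oppProb s u := by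
  unfold oppProb; split_ifs <;> linarith

theorem oppProb_le_one {s : Bool} {u : ℝ} (h0 : 0 ≤ u) (h1 : u ≤ 1) : oppProb s u ≤ 1 := by
  unfold oppProb; split_ifs <;> linarith

theorem oppProb_le {s : Bool} {u : ℝ} : oppProb s u ≤ 1 / 2 + |u - 1 / 2| := by
  unfold oppProb
  split_ifs
  · linarith [neg_abs_le (u - 1 / 2)]
  · linarith [le_abs_self (u - 1 / 2)]

/-- The sign `±1` encoded by a Boolean. -/
def boolSign (s : Bool) : ℝ := if s then 1 else -1

theorem boolSign_sq (s : Bool) : boolSign s ^ 2 = 1 := by cases s <;> simp [boolSign]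

theorem abs_boolSign (s : Bool) : |boolSign s| = 1 := by cases s <;> simp [boolSign]

theorem oppProb_sigmoid (s : Bool) (x : ℝ) :
    oppProb s (Real.sigmoid x) = Real.sigmoid (-boolSign s * x) := by
  cases s <;> simp [oppProb, boolSign, Real.sigmoid_neg]

/-! ### Belief Propagation on the tree as a recursion for log-odds -/

theorem normalise_pos {w : Bool → ℝ} (hw : ∀ s, 0 < w s) (s : Bool) : 0 < normalise w s :=
  div_pos (hw s) (add_pos (hw _) (hw _))

namespace Formula

variable {V C : Type} [DecidableEq V]

theorem sum_clauseWeight_eq (F : Formula V C) (β : ℝ) (ν : V → C → Bool → ℝ) (a : C) (x : V)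
    (hx : x ∈ F.vars a) (hν : ∀ y ∈ F.vars a, y ≠ x → ν y a true + ν y a false = 1) (s : Bool) :
    ∑ σ : F.vars a → Bool,
      (if ∀ y : F.vars a, (y : V) = x → σ y = s then 1 else 0) *
        Real.exp (-β * (if F.Satisfies a σ then 0 else 1)) *
        ∏ y ∈ Finset.univ.filter (fun y : F.vars a => (y : V) ≠ x), ν y a (σ y) =
      if s = F.sign a x then 1
      else 1 - (1 - Real.exp (-β)) * ∏ y ∈ (F.vars a).erase x, ν y a (!F.sign a y) := by
  classical
  let g : F.vars a → Bool → ℝ := fun y b =>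
    if (y : V) = x then (if b = s then 1 else 0) else ν y a b
  let h : F.vars a → Bool → ℝ := fun y b => g y b * if b = F.sign a y then 0 else 1
  -- the weight of `σ` is a difference of two products over the variables of `a`
  have hterm : ∀ σ : F.vars a → Bool,
      (if ∀ y : F.vars a, (y : V) = x → σ y = s then (1 : ℝ) else 0) *
        Real.exp (-β * (if F.Satisfies a σ then 0 else 1)) *
        ∏ y ∈ Finset.univ.filter (fun y : F.vars a => (y : V) ≠ x), ν y a (σ y) =
      ∏ y, g y (σ y) - (1 - Real.exp (-β)) * ∏ y, h y (σ y) := by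
    intro σ
    have hg : ∏ y, g y (σ y) = (if ∀ y : F.vars a, (y : V) = x → σ y = s then (1 : ℝ) else 0) *
        ∏ y ∈ Finset.univ.filter (fun y : F.vars a => (y : V) ≠ x), ν y a (σ y) := by
      rw [Finset.prod_filter]
      by_cases hs : ∀ y : F.vars a, (y : V) = x → σ y = s
      · rw [if_pos hs, one_mul]
        refine Finset.prod_congr rfl fun y _ => ?_
        by_cases hy : (y : V) = x <;> simp [g, hy, hs]
      · rw [if_neg hs, zero_mul]
        push Not at hs
        obtain ⟨y, hy, hys⟩ := hs
        exact Finset.prod_eq_zero (Finset.mem_univ y) (by simp [g, hy, hys])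
    have hh : ∏ y, h y (σ y) = (∏ y, g y (σ y)) * if F.Satisfies a σ then 0 else 1 := by
      rw [Finset.prod_mul_distrib]
      congr 1
      by_cases hs : F.Satisfies a σ
      · rw [if_pos hs]
        obtain ⟨y, hy⟩ := hs
        exact Finset.prod_eq_zero (Finset.mem_univ y) (by simp [hy])
      · rw [if_neg hs]
        refine Finset.prod_eq_one fun y _ => ?_
        rw [if_neg fun hy => hs ⟨y, hy⟩]
    rw [hh, hg]
    split_ifs <;> simp
    ring
  have hswap : ∀ f : F.vars a → Bool → ℝ,
      ∑ σ : F.vars a → Bool, ∏ y, f y (σ y) = ∏ y, (f y true + f y false) := by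
    intro f
    have := Finset.prod_univ_sum (fun _ : F.vars a => (Finset.univ : Finset Bool)) f
    simp only [Fintype.piFinset_univ, Fintype.sum_bool] at this
    exact this.symm
  have hsplit : ∀ f : V → ℝ, ∏ y : F.vars a, f y = f x * ∏ y ∈ (F.vars a).erase x, f y := by
    intro f
    rw [Finset.prod_coe_sort (F.vars a) f, Finset.mul_prod_erase _ _ hx]
  simp only [hterm]
  rw [Finset.sum_sub_distrib, ← Finset.mul_sum, hswap, hswap]
  have hg1 : ∏ y, (g y true + g y false) = 1 := by
    refine Finset.prod_eq_one fun y _ => ?_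
    by_cases hy : (y : V) = x
    · cases s <;> simp [g, hy]
    · simp [g, hy, hν y y.2 hy]
  have hh1 : ∏ y, (h y true + h y false) =
      (if s = F.sign a x then 0 else 1) * ∏ y ∈ (F.vars a).erase x, ν y a (!F.sign a y) := by
    have := hsplit fun y => if y = x then (if s = F.sign a x then 0 else 1)
      else ν y a (!F.sign a y)
    simp only [if_true] at this
    rw [Finset.prod_congr rfl (g := fun y => ν y a (!F.sign a y))
      (fun y hy => if_neg (Finset.ne_of_mem_erase hy))] at this
    rw [← this]
    refine Finset.prod_congr rfl fun y _ => ?_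
    by_cases hy : (y : V) = x
    · simp only [h, g, hy, if_true]
      cases s <;> cases F.sign a x <;> simp
    · simp only [h, g, hy, if_false]
      cases F.sign a y <;> simp
  rw [hg1, hh1]
  split_ifs <;> simp

end Formula

/-- A product of clause-to-variable messages, normalised, in terms of log-odds. -/
theorem normalise_prod_eq_sigmoid {ι : Type*} (s : Finset ι) (v : ι → Bool → ℝ) (ℓ : ι → ℝ)
    (hpos : ∀ b ∈ s, 0 < v b true) (hv : ∀ b ∈ s, v b false = v b true * Real.exp (-ℓ b)) :
    normalise (fun r => ∏ b ∈ s, v b r) = bernoulliMsg (Real.sigmoid (∑ b ∈ s, ℓ b)) := by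
  have h1 : ∏ b ∈ s, v b false = (∏ b ∈ s, v b true) * Real.exp (-∑ b ∈ s, ℓ b) := by
    rw [Finset.prod_congr rfl hv, Finset.prod_mul_distrib, ← Real.exp_sum, Finset.sum_neg_distrib]
  have h2 : 0 < ∏ b ∈ s, v b true := Finset.prod_pos hpos
  have h3 := Real.exp_pos (-∑ b ∈ s, ℓ b)
  funext r
  cases r
  · simp only [normalise, bernoulliMsg, h1, Real.sigmoid_def]
    simp only [Bool.false_eq_true, if_false]
    field_simp
    ring
  · simp only [normalise, bernoulliMsg, h1, Real.sigmoid_def, if_true]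
    field_simp

/-- The probability that no child variable of the clause `(x, i)` satisfies it, when the child
variables are independent with marginals `u`. -/
def missProb {k : ℕ} (τ : TreeData k) (u : TVar k → ℝ) (x : TVar k) (i : ℕ) : ℝ :=
  ∏ j : Fin (k - 1), oppProb (τ.2 ((x, i), (i, j) :: x)) (u ((i, j) :: x))

theorem missProb_nonneg {k : ℕ} (τ : TreeData k) {u : TVar k → ℝ} (hu : ∀ x, 0 ≤ u x ∧ u x ≤ 1)
    (x : TVar k) (i : ℕ) : 0 ≤ missProb τ u x i :=
  Finset.prod_nonneg fun _ _ => oppProb_nonneg (hu _).1 (hu _).2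

theorem missProb_le_one {k : ℕ} (τ : TreeData k) {u : TVar k → ℝ} (hu : ∀ x, 0 ≤ u x ∧ u x ≤ 1)
    (x : TVar k) (i : ℕ) : missProb τ u x i ≤ 1 :=
  Finset.prod_le_one (fun _ _ => oppProb_nonneg (hu _).1 (hu _).2)
    fun _ _ => oppProb_le_one (hu _).1 (hu _).2

/-- The log-odds of a variable of the tree, given the messages from its grandchildren. -/
def logOdds {k : ℕ} (β : ℝ) (τ : TreeData k) (u : TVar k → ℝ) (x : TVar k) : ℝ :=
  ∑ i ∈ Finset.range (τ.1 x), boolSign (τ.2 ((x, i), x)) *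
    clauseLog β (missProb τ u x i)

/-- The message `μ_{x → a,t}(1)` from the variable `x` to its parent clause `a` (for the root: the
marginal) after `t` rounds, as a function of the initial messages `u`. -/
def upMsg {k : ℕ} (β : ℝ) (τ : TreeData k) (u : TVar k → ℝ) : ℕ → TVar k → ℝ
  | 0 => u
  | t + 1 => fun x => Real.sigmoid (logOdds β τ (upMsg β τ u t) x)

/-- The initial message from a variable to its parent clause; the root has none and is given an
arbitrary one. -/
def upInit {k : ℕ} (η : InitData k) : TVar k → ℝ
  | [] => η.2 ([], ([], 0))
  | (i, j) :: y => η.2 ((i, j) :: y, (y, i))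

theorem upMsg_mem {k : ℕ} {β : ℝ} {τ : TreeData k} {u : TVar k → ℝ}
    (hu : ∀ x, 0 ≤ u x ∧ u x ≤ 1) (t : ℕ) (x : TVar k) :
    0 ≤ upMsg β τ u t x ∧ upMsg β τ u t x ≤ 1 := by
  cases t with
  | zero => exact hu x
  | succ t => exact ⟨Real.sigmoid_nonneg _, Real.sigmoid_le_one _⟩

theorem upInit_mem {k : ℕ} (η : InitData k) (x : TVar k) : 0 ≤ upInit η x ∧ upInit η x ≤ 1 := by
  rcases x with _ | ⟨⟨i, j⟩, y⟩
  · exact ⟨(η.2 _).2.1, (η.2 _).2.2⟩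
  · exact ⟨(η.2 _).2.1, (η.2 _).2.2⟩

theorem cons_ne {k : ℕ} (p : ℕ × Fin (k - 1)) (x : TVar k) : p :: x ≠ x := fun h => by
  simpa using congrArg List.length h

/-- Normalising the product of the messages from the child clauses of `x` gives the message
computed from the log-odds. -/
theorem normalise_prod_clauseUpdate {k : ℕ} {β : ℝ} (hβ : 0 ≤ β) (τ : TreeData k)
    (ν : TVar k → TClause k → Bool → ℝ) (u : TVar k → ℝ) (hu : ∀ x, 0 ≤ u x ∧ u x ≤ 1)
    (hνu : ∀ i j x, ν ((i, j) :: x) (x, i) = bernoulliMsg (u ((i, j) :: x))) (x : TVar k) :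
    normalise (fun s => ∏ b ∈ (Finset.range (τ.1 x)).image fun i => ((x, i) : TClause k),
      (treeFormula τ).clauseUpdate β ν b x s) = bernoulliMsg (Real.sigmoid (logOdds β τ u x)) := by
  have hprod : (fun s => ∏ b ∈ (Finset.range (τ.1 x)).image fun i => ((x, i) : TClause k),
      (treeFormula τ).clauseUpdate β ν b x s) = fun s => ∏ i ∈ Finset.range (τ.1 x),
      (treeFormula τ).clauseUpdate β ν (x, i) x s := by
    funext s
    rw [Finset.prod_image]
    intro i _ j _ h
    exact (Prod.mk.inj h).2
  rw [hprod]
  have hw : ∀ i ∈ Finset.range (τ.1 x), (treeFormula τ).clauseUpdate β ν (x, i) x =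
      normalise fun s => if s = τ.2 ((x, i), x) then 1 else 1 - (1 - Real.exp (-β)) *
        missProb τ u x i := by
    intro i hi
    rw [Finset.mem_range] at hi
    have hvars : (treeFormula τ).vars (x, i) =
        insert x (Finset.univ.image fun j : Fin (k - 1) => (i, j) :: x) := by
      simp [treeFormula, treeVars, hi]
    have hnot : x ∉ Finset.univ.image fun j : Fin (k - 1) => (i, j) :: x := by
      simp only [Finset.mem_image, not_exists, not_and]
      exact fun j _ => cons_ne _ _
    unfold Formula.clauseUpdate missProb
    congr 1
    funext s
    rw [Formula.sum_clauseWeight_eq]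
    · rw [hvars, Finset.erase_insert hnot, Finset.prod_image]
      · simp only [hνu]
        congr 3
        refine Finset.prod_congr rfl fun j _ => ?_
        change bernoulliMsg _ (!τ.2 ((x, i), (i, j) :: x)) = _
        cases τ.2 ((x, i), (i, j) :: x) <;> simp [bernoulliMsg, oppProb]
      · intro j _ j' _ h
        simpa using h
    · rw [hvars]
      exact Finset.mem_insert_self _ _
    · rw [hvars]
      intro y hy hyx
      rcases Finset.mem_insert.1 hy with rfl | hy
      · exact absurd rfl hyx
      · obtain ⟨j, -, rfl⟩ := Finset.mem_image.1 hy
        rw [hνu]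
        simp [bernoulliMsg]
  have he : Real.exp (-β) ≤ 1 := Real.exp_le_one_iff.2 (by linarith)
  have he' := Real.exp_pos (-β)
  have hpos : ∀ i, 0 < 1 - (1 - Real.exp (-β)) *
        missProb τ u x i := by
    intro i
    have h0 := missProb_nonneg τ hu x i
    have h1 := missProb_le_one τ hu x i
    nlinarith
  refine normalise_prod_eq_sigmoid _ _ _ ?_ ?_
  · intro i hi
    rw [hw i hi]
    refine normalise_pos (fun s => ?_) _
    split_ifs
    · exact one_pos
    · exact hpos i
  · intro i hi
    rw [hw i hi]
    simp only [normalise]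
    rw [div_mul_eq_mul_div]
    congr 1
    cases τ.2 ((x, i), x)
    · have h := Real.exp_log (hpos i)
      simp only [boolSign, clauseLog, Bool.false_eq_true, if_false, neg_mul, one_mul, neg_neg,
        Real.exp_neg (Real.log _), h]
      simp [(hpos i).ne']
    · simp [boolSign, clauseLog, Real.exp_log (hpos i)]

theorem treeClauses_erase_parent {k : ℕ} (N : TVar k → ℕ) (x : TVar k) (i : ℕ) (j : Fin (k - 1)) :
    (treeClauses N ((i, j) :: x)).erase (x, i) =
      (Finset.range (N ((i, j) :: x))).image fun l => (((i, j) :: x, l) : TClause k) := by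
  ext ⟨y, l⟩
  simp only [treeClauses, treeParent, Finset.mem_erase, Finset.mem_union, Finset.mem_image,
    Finset.mem_range, ne_eq, Prod.mk.injEq]
  constructor
  · rintro ⟨h1, h2 | h2⟩
    · exact h2
    · split_ifs at h2
      · simp at h2
        exact absurd h2 h1
      · simp at h2
  · rintro ⟨l', h, rfl, rfl⟩
    exact ⟨fun h => cons_ne _ _ h.1, Or.inl ⟨l', h, rfl, rfl⟩⟩

theorem bp_toClause_eq_upMsg {k : ℕ} {β : ℝ} (hβ : 0 ≤ β) (τ : TreeData k) (η : InitData k)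
    (t i : ℕ) (j : Fin (k - 1)) (x : TVar k) :
    ((treeFormula τ).bp β (initMessages η) t).toClause ((i, j) :: x) (x, i) =
      bernoulliMsg (upMsg β τ (upInit η) t ((i, j) :: x)) := by
  induction t generalizing i j x with
  | zero => rfl
  | succ t ih =>
    change (treeFormula τ).varUpdate _ _ _ = _
    unfold Formula.varUpdate
    change normalise (fun s => ∏ b ∈ (treeClauses τ.1 ((i, j) :: x)).erase (x, i), _) = _
    rw [treeClauses_erase_parent]
    exact normalise_prod_clauseUpdate hβ τ _ _ (upMsg_mem (upInit_mem η) t) ih _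

theorem rootMarginal_succ {k : ℕ} {β : ℝ} (hβ : 0 ≤ β) (τ : TreeData k) (η : InitData k) (t : ℕ) :
    rootMarginal β τ η (t + 1) = upMsg β τ (upInit η) (t + 1) [] := by
  have h : treeClauses τ.1 [] =
      (Finset.range (τ.1 [])).image fun l => (([], l) : TClause k) := by
    simp [treeClauses, treeParent]
  unfold rootMarginal Formula.bpMarginal
  change normalise (fun s => ∏ b ∈ treeClauses τ.1 [], _) true = _
  rw [h]
  have := normalise_prod_clauseUpdate hβ τ _ _ (upMsg_mem (upInit_mem η) t)
    (fun i j x => bp_toClause_eq_upMsg hβ τ η t i j x) []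
  exact congrFun this true

/-! ### Independent coordinates and randomly signed sums -/

/-- Independent families of `σ`-algebras on the two factors are jointly independent on a product. -/
theorem iIndep_prod_sumElim {Ω₁ Ω₂ ι₁ ι₂ : Type*} [MeasurableSpace Ω₁] [MeasurableSpace Ω₂]
    {μ : Measure Ω₁} {ν : Measure Ω₂} [IsProbabilityMeasure μ] [IsProbabilityMeasure ν]
    {m₁ : ι₁ → MeasurableSpace Ω₁} {m₂ : ι₂ → MeasurableSpace Ω₂}
    (h₁ : iIndep m₁ μ) (h₂ : iIndep m₂ ν) :
    iIndep (Sum.elim (fun i => (m₁ i).comap Prod.fst) fun i => (m₂ i).comap Prod.snd)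
      (μ.prod ν) := by
  classical
  rw [iIndep_iff] at *
  intro s f hf
  have hA : ∀ i, ∃ A : Set Ω₁, Sum.inl i ∈ s → MeasurableSet[m₁ i] A ∧
      Prod.fst ⁻¹' A = f (Sum.inl i) := fun i => by
    by_cases hi : Sum.inl i ∈ s
    · obtain ⟨A, hA⟩ := hf _ hi
      exact ⟨A, fun _ => hA⟩
    · exact ⟨∅, fun h => absurd h hi⟩
  have hB : ∀ i, ∃ B : Set Ω₂, Sum.inr i ∈ s → MeasurableSet[m₂ i] B ∧
      Prod.snd ⁻¹' B = f (Sum.inr i) := fun i => by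
    by_cases hi : Sum.inr i ∈ s
    · obtain ⟨B, hB⟩ := hf _ hi
      exact ⟨B, fun _ => hB⟩
    · exact ⟨∅, fun h => absurd h hi⟩
  choose A hA using hA
  choose B hB using hB
  have hset : ⋂ i ∈ s, f i = (⋂ i ∈ s.toLeft, A i) ×ˢ (⋂ i ∈ s.toRight, B i) := by
    ext ⟨a, b⟩
    simp only [Set.mem_iInter, Set.mem_prod, Finset.mem_toLeft, Finset.mem_toRight, Sum.forall]
    refine and_congr (forall₂_congr fun i hi => ?_) (forall₂_congr fun i hi => ?_)
    · rw [← (hA i hi).2]; rfl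
    · rw [← (hB i hi).2]; rfl
  rw [hset, Measure.prod_prod, h₁ _ fun i hi => (hA i (Finset.mem_toLeft.1 hi)).1,
    h₂ _ fun i hi => (hB i (Finset.mem_toRight.1 hi)).1]
  conv_rhs => rw [← Finset.toLeft_disjSum_toRight (u := s), Finset.prod_disjSum]
  congr 1
  · refine Finset.prod_congr rfl fun i hi => ?_
    rw [← (hA i (Finset.mem_toLeft.1 hi)).2, ← Set.prod_univ, Measure.prod_prod, measure_univ,
      mul_one]
  · refine Finset.prod_congr rfl fun i hi => ?_
    rw [← (hB i (Finset.mem_toRight.1 hi)).2, ← Set.univ_prod, Measure.prod_prod, measure_univ,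
      one_mul]

theorem iIndep_comap_eval_infinitePi {ι : Type*} {X : ι → Type*} [∀ i, MeasurableSpace (X i)]
    (μ : ∀ i, Measure (X i)) [∀ i, IsProbabilityMeasure (μ i)] :
    iIndep (fun i => MeasurableSpace.comap (fun ω : (∀ j, X j) => ω i) inferInstance)
      (Measure.infinitePi μ) :=
  iIndepFun_infinitePi (X := fun i (x : X i) => x) (fun _ => measurable_id)

/-- The sample space of a signed tree together with initial messages. -/
abbrev Sample (k : ℕ) : Type := TreeData k × InitData k

/-- The joint law of the tree and of initial messages drawn from `π`. -/
abbrev sampleLaw (k : ℕ) (d : ℝ) (π : Measure unitInterval) [IsProbabilityMeasure π] :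
    Measure (Sample k) :=
  (treeLaw k d).prod (initLaw k π)

instance (k : ℕ) (π : Measure unitInterval) [IsProbabilityMeasure π] :
    IsProbabilityMeasure (initLaw k π) := by
  unfold initLaw; infer_instance

/-- Labels of the independent coordinates of a sample: numbers of child clauses, signs, and initial
messages in either direction. -/
abbrev Coord (k : ℕ) : Type :=
  (TVar k ⊕ TClause k × TVar k) ⊕ (TClause k × TVar k ⊕ TVar k × TClause k)

/-- The `σ`-algebra generated by a single coordinate. -/
def coordAlg (k : ℕ) : Coord k → MeasurableSpace (Sample k) :=
  Sum.elim
    (fun i => (Sum.elim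
      (fun i : TVar k => (MeasurableSpace.comap (fun ω : TVar k → ℕ => ω i)
        inferInstance).comap Prod.fst)
      (fun i : TClause k × TVar k => (MeasurableSpace.comap
        (fun ω : TClause k × TVar k → Bool => ω i) inferInstance).comap Prod.snd) i).comap
      Prod.fst)
    (fun i => (Sum.elim
      (fun i : TClause k × TVar k => (MeasurableSpace.comap
        (fun ω : TClause k × TVar k → unitInterval => ω i) inferInstance).comap Prod.fst)
      (fun i : TVar k × TClause k => (MeasurableSpace.comap
        (fun ω : TVar k × TClause k → unitInterval => ω i) inferInstance).comap Prod.snd) i).comap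
      Prod.snd)

theorem iIndep_coordAlg (k : ℕ) (d : ℝ) (π : Measure unitInterval) [IsProbabilityMeasure π] :
    iIndep (coordAlg k) (sampleLaw k d π) :=
  iIndep_prod_sumElim
    (iIndep_prod_sumElim (iIndep_comap_eval_infinitePi _) (iIndep_comap_eval_infinitePi _))
    (iIndep_prod_sumElim (iIndep_comap_eval_infinitePi _) (iIndep_comap_eval_infinitePi _))

theorem coordAlg_le (k : ℕ) (c : Coord k) : coordAlg k c ≤ Prod.instMeasurableSpace := by
  rcases c with (x | p) | (p | p)
  · change MeasurableSpace.comap _ (MeasurableSpace.comap _ (MeasurableSpace.comap _ _)) ≤ _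
    rw [MeasurableSpace.comap_comp, MeasurableSpace.comap_comp]
    exact Measurable.comap_le (f := fun ω : Sample k => ω.1.1 x) (by fun_prop)
  · change MeasurableSpace.comap _ (MeasurableSpace.comap _ (MeasurableSpace.comap _ _)) ≤ _
    rw [MeasurableSpace.comap_comp, MeasurableSpace.comap_comp]
    exact Measurable.comap_le (f := fun ω : Sample k => ω.1.2 p) (by fun_prop)
  · change MeasurableSpace.comap _ (MeasurableSpace.comap _ (MeasurableSpace.comap _ _)) ≤ _
    rw [MeasurableSpace.comap_comp, MeasurableSpace.comap_comp]
    exact Measurable.comap_le (f := fun ω : Sample k => ω.2.1 p) (by fun_prop)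
  · change MeasurableSpace.comap _ (MeasurableSpace.comap _ (MeasurableSpace.comap _ _)) ≤ _
    rw [MeasurableSpace.comap_comp, MeasurableSpace.comap_comp]
    exact Measurable.comap_le (f := fun ω : Sample k => ω.2.2 p) (by fun_prop)

/-- The `σ`-algebra generated by a set of coordinates. -/
def coordsAlg {k : ℕ} (S : Set (Coord k)) : MeasurableSpace (Sample k) := ⨆ c ∈ S, coordAlg k c

theorem coordsAlg_le {k : ℕ} (S : Set (Coord k)) : coordsAlg S ≤ Prod.instMeasurableSpace :=
  iSup₂_le fun c _ => coordAlg_le k c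

theorem coordsAlg_mono {k : ℕ} {S T : Set (Coord k)} (h : S ⊆ T) : coordsAlg S ≤ coordsAlg T :=
  biSup_mono h

theorem coordAlg_le_coordsAlg {k : ℕ} {S : Set (Coord k)} {c : Coord k} (h : c ∈ S) :
    coordAlg k c ≤ coordsAlg S := le_iSup₂_of_le c h le_rfl

theorem measurable_degree {k : ℕ} {S : Set (Coord k)} {x : TVar k}
    (h : Sum.inl (Sum.inl x) ∈ S) : Measurable[coordsAlg S] fun ω : Sample k => ω.1.1 x :=
  Measurable.mono (((comap_measurable _).comp (comap_measurable _)).comp (comap_measurable _) :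
    Measurable[coordAlg k (Sum.inl (Sum.inl x))] fun ω : Sample k => ω.1.1 x)
    (coordAlg_le_coordsAlg h) le_rfl

theorem measurable_sign {k : ℕ} {S : Set (Coord k)} {p : TClause k × TVar k}
    (h : Sum.inl (Sum.inr p) ∈ S) : Measurable[coordsAlg S] fun ω : Sample k => ω.1.2 p :=
  Measurable.mono (((comap_measurable _).comp (comap_measurable _)).comp (comap_measurable _) :
    Measurable[coordAlg k (Sum.inl (Sum.inr p))] fun ω : Sample k => ω.1.2 p)
    (coordAlg_le_coordsAlg h) le_rfl

theorem measurable_init {k : ℕ} {S : Set (Coord k)} {p : TVar k × TClause k}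
    (h : Sum.inr (Sum.inr p) ∈ S) : Measurable[coordsAlg S] fun ω : Sample k => ω.2.2 p :=
  Measurable.mono (((comap_measurable _).comp (comap_measurable _)).comp (comap_measurable _) :
    Measurable[coordAlg k (Sum.inr (Sum.inr p))] fun ω : Sample k => ω.2.2 p)
    (coordAlg_le_coordsAlg h) le_rfl

section Independence

variable {k : ℕ} {d : ℝ} {π : Measure unitInterval} [IsProbabilityMeasure π]

theorem indep_coordsAlg {S T : Set (Coord k)} (h : Disjoint S T) :
    Indep (coordsAlg S) (coordsAlg T) (sampleLaw k d π) :=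
  indep_iSup_of_disjoint (coordAlg_le k) (iIndep_coordAlg k d π) h

theorem lintegral_mul_of_disjoint {S T : Set (Coord k)} (h : Disjoint S T)
    {f g : Sample k → ℝ≥0∞} (hf : Measurable[coordsAlg S] f) (hg : Measurable[coordsAlg T] g) :
    ∫⁻ ω, f ω * g ω ∂sampleLaw k d π =
      (∫⁻ ω, f ω ∂sampleLaw k d π) * ∫⁻ ω, g ω ∂sampleLaw k d π :=
  lintegral_mul_eq_lintegral_mul_lintegral_of_independent_measurableSpace (coordsAlg_le S)
    (coordsAlg_le T) (indep_coordsAlg h) hf hg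

theorem lintegral_prod_of_disjoint {ι : Type*} (s : Finset ι) {S : ι → Set (Coord k)}
    (h : ∀ i j, i ≠ j → Disjoint (S i) (S j)) {f : ι → Sample k → ℝ≥0∞}
    (hf : ∀ i, Measurable[coordsAlg (S i)] (f i)) :
    ∫⁻ ω, ∏ i ∈ s, f i ω ∂sampleLaw k d π = ∏ i ∈ s, ∫⁻ ω, f i ω ∂sampleLaw k d π := by
  classical
  induction s using Finset.induction_on with
  | empty => simp
  | insert a s ha ih =>
    simp only [Finset.prod_insert ha]
    rw [← ih]
    refine lintegral_mul_of_disjoint (S := S a) (T := ⋃ i ∈ s, S i) ?_ (hf a) ?_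
    · rw [Set.disjoint_iUnion₂_right]
      exact fun i hi => h a i fun e => ha (e ▸ hi)
    · refine Finset.measurable_fun_prod s fun i hi => ?_
      exact (hf i).mono (coordsAlg_mono (Set.subset_biUnion_of_mem (u := S) hi)) le_rfl

end Independence

theorem lintegral_natCast_poissonMeasure (r : NNReal) :
    ∫⁻ n : ℕ, (n : ℝ≥0∞) ∂poissonMeasure r = r := by
  rw [lintegral_countable', tsum_eq_zero_add' ENNReal.summable]
  have h : ∀ n : ℕ, ((n + 1 : ℕ) : ℝ≥0∞) * poissonMeasure r {n + 1} =
      r * poissonMeasure r {n} := fun n => by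
    rw [poissonMeasure_singleton, poissonMeasure_singleton, ← ENNReal.ofReal_natCast,
      ← ENNReal.ofReal_coe_nnreal, ← ENNReal.ofReal_mul (by positivity),
      ← ENNReal.ofReal_mul (by positivity)]
    congr 1
    rw [Nat.factorial_succ]
    push_cast
    field_simp
    ring
  simp_rw [h]
  rw [ENNReal.tsum_mul_left]
  have h1 : ∑' n : ℕ, poissonMeasure r {n} = 1 := by
    have := lintegral_countable' (μ := poissonMeasure r) (fun _ : ℕ => (1 : ℝ≥0∞))
    simpa using this.symm
  rw [h1]
  simp

theorem map_degree {k : ℕ} {d : ℝ} {π : Measure unitInterval} [IsProbabilityMeasure π]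
    (x : TVar k) : (sampleLaw k d π).map (fun ω => ω.1.1 x) = poissonMeasure d.toNNReal := by
  have h := ((measurePreserving_eval_infinitePi (fun _ : TVar k => poissonMeasure d.toNNReal)
    x).comp (measurePreserving_fst (ν := Measure.infinitePi fun _ : TClause k × TVar k =>
      (PMF.uniformOfFintype Bool).toMeasure))).comp
    (measurePreserving_fst (μ := treeLaw k d) (ν := initLaw k π))
  exact h.map_eq

theorem map_sign {k : ℕ} {d : ℝ} {π : Measure unitInterval} [IsProbabilityMeasure π]
    (p : TClause k × TVar k) :
    (sampleLaw k d π).map (fun ω => ω.1.2 p) = (PMF.uniformOfFintype Bool).toMeasure := by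
  have h := ((measurePreserving_eval_infinitePi (fun _ : TClause k × TVar k =>
    (PMF.uniformOfFintype Bool).toMeasure)
    p).comp (measurePreserving_snd (μ := Measure.infinitePi fun _ : TVar k =>
      poissonMeasure d.toNNReal))).comp
    (measurePreserving_fst (μ := treeLaw k d) (ν := initLaw k π))
  exact h.map_eq

theorem map_init {k : ℕ} {d : ℝ} {π : Measure unitInterval} [IsProbabilityMeasure π]
    (p : TVar k × TClause k) :
    (sampleLaw k d π).map (fun ω => ω.2.2 p) = π := by
  have h := ((measurePreserving_eval_infinitePi (fun _ : TVar k × TClause k => π)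
    p).comp (measurePreserving_snd (μ := Measure.infinitePi fun _ : TClause k × TVar k => π))).comp
    (measurePreserving_snd (μ := treeLaw k d) (ν := initLaw k π))
  exact h.map_eq

theorem integral_boolSign {k : ℕ} {d : ℝ} {π : Measure unitInterval} [IsProbabilityMeasure π]
    (p : TClause k × TVar k) : ∫ ω, boolSign (ω.1.2 p) ∂sampleLaw k d π = 0 := by
  have hm : Measurable fun ω : Sample k => ω.1.2 p := by fun_prop
  have h := integral_map (μ := sampleLaw k d π) hm.aemeasurable (f := boolSign)
    (measurable_of_countable boolSign).aestronglyMeasurable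
  rw [← h, map_sign, PMF.integral_eq_sum]
  simp [boolSign]

section Sums

variable {k : ℕ} {d : ℝ} {π : Measure unitInterval} [IsProbabilityMeasure π]

/-- Wald's inequality for the Poisson number of child clauses of a variable. -/
theorem lintegral_degree_le {S : Set (Coord k)} {x : TVar k} (hx : Sum.inl (Sum.inl x) ∉ S)
    {H : ℕ → Sample k → ℝ≥0∞} (hH : ∀ n, Measurable[coordsAlg S] (H n)) {M : ℝ≥0∞}
    (hM : ∀ n, ∫⁻ ω, H n ω ∂sampleLaw k d π ≤ n * M) :
    ∫⁻ ω, H (ω.1.1 x) ω ∂sampleLaw k d π ≤ ENNReal.ofReal d * M := by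
  have hN : Measurable[coordsAlg {Sum.inl (Sum.inl x)}] fun ω : Sample k => ω.1.1 x :=
    measurable_degree rfl
  let I : ℕ → Sample k → ℝ≥0∞ := fun n ω => if ω.1.1 x = n then 1 else 0
  have hI : ∀ n, Measurable[coordsAlg {Sum.inl (Sum.inl x)}] (I n) := fun n =>
    Measurable.comp (measurable_of_countable fun m : ℕ => if m = n then (1 : ℝ≥0∞) else 0) hN
  have hdisj : Disjoint {Sum.inl (Sum.inl x)} S := Set.disjoint_singleton_left.2 hx
  have hexp : ∀ ω, H (ω.1.1 x) ω = ∑' n, I n ω * H n ω := fun ω => by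
    rw [tsum_eq_single (ω.1.1 x) fun n hn => by simp [I, hn.symm]]
    simp [I]
  have hexp' : ∀ ω : Sample k, ((ω.1.1 x : ℕ) : ℝ≥0∞) = ∑' n, I n ω * (n : ℝ≥0∞) := fun ω => by
    rw [tsum_eq_single (ω.1.1 x) fun n hn => by simp [I, hn.symm]]
    simp [I]
  have hmI : ∀ n, Measurable (I n) := fun n => (hI n).mono (coordsAlg_le _) le_rfl
  have hmean : ∫⁻ ω : Sample k, ((ω.1.1 x : ℕ) : ℝ≥0∞) ∂sampleLaw k d π = ENNReal.ofReal d := by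
    have := lintegral_map (μ := sampleLaw k d π) (f := fun n : ℕ => (n : ℝ≥0∞))
      (g := fun ω => ω.1.1 x) (by fun_prop) (by fun_prop)
    rw [← this, map_degree, lintegral_natCast_poissonMeasure]
    rfl
  calc ∫⁻ ω, H (ω.1.1 x) ω ∂sampleLaw k d π
      = ∑' n, ∫⁻ ω, I n ω * H n ω ∂sampleLaw k d π := by
        simp_rw [hexp]
        exact lintegral_tsum fun n =>
          ((hmI n).mul ((hH n).mono (coordsAlg_le _) le_rfl)).aemeasurable
    _ = ∑' n, (∫⁻ ω, I n ω ∂sampleLaw k d π) * ∫⁻ ω, H n ω ∂sampleLaw k d π :=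
        tsum_congr fun n => lintegral_mul_of_disjoint hdisj (hI n) (hH n)
    _ ≤ ∑' n, (∫⁻ ω, I n ω ∂sampleLaw k d π) * (n * M) := by
        gcongr with n
        exact hM n
    _ = (∑' n, ∫⁻ ω, I n ω * n ∂sampleLaw k d π) * M := by
        rw [← ENNReal.tsum_mul_right]
        refine tsum_congr fun n => ?_
        rw [lintegral_mul_const _ (hmI n), mul_assoc]
    _ = ENNReal.ofReal d * M := by
        rw [← lintegral_tsum fun n => ((hmI n).mul_const _).aemeasurable, ← hmean]
        simp_rw [hexp']

/-- Independent signs make the terms of a sum orthogonal. -/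
theorem integral_sq_sum_sign {S : Set (Coord k)} {x : TVar k}
    (hx : ∀ i, Sum.inl (Sum.inr ((x, i), x)) ∉ S) {D : ℕ → Sample k → ℝ}
    (hD : ∀ n, Measurable[coordsAlg S] (D n)) {C : ℝ} (hC : ∀ n ω, |D n ω| ≤ C) (n : ℕ) :
    ∫ ω, (∑ i ∈ Finset.range n, boolSign (ω.1.2 ((x, i), x)) * D i ω) ^ 2 ∂sampleLaw k d π =
      ∑ i ∈ Finset.range n, ∫ ω, D i ω ^ 2 ∂sampleLaw k d π := by
  have hC0 : 0 ≤ C := (abs_nonneg _).trans (hC 0 ((fun _ => 0, fun _ => true), halfInit k))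
  have hDm : ∀ i, Measurable (D i) := fun i => (hD i).mono (coordsAlg_le _) le_rfl
  have hJm : ∀ i, Measurable fun ω : Sample k => boolSign (ω.1.2 ((x, i), x)) := fun i =>
    (measurable_of_countable boolSign).comp (by fun_prop)
  induction n with
  | zero => simp
  | succ n ih =>
    set T : Set (Coord k) := {c | ∃ i < n, c = Sum.inl (Sum.inr ((x, i), x))}
    set W : Sample k → ℝ := fun ω =>
      ∑ i ∈ Finset.range n, boolSign (ω.1.2 ((x, i), x)) * D i ω with hW
    have hWm : Measurable[coordsAlg (S ∪ T)] W := by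
      refine Finset.measurable_fun_sum _ fun i hi => ?_
      refine Measurable.mul ?_ ((hD i).mono (coordsAlg_mono Set.subset_union_left) le_rfl)
      exact (measurable_of_countable boolSign).comp
        (measurable_sign (Or.inr ⟨i, Finset.mem_range.1 hi, rfl⟩))
    have hWD : Measurable[coordsAlg (S ∪ T)] fun ω => W ω * D n ω :=
      hWm.mul ((hD n).mono (coordsAlg_mono Set.subset_union_left) le_rfl)
    have hWm' : Measurable W := hWm.mono (coordsAlg_le _) le_rfl
    have hWb : ∀ ω, |W ω| ≤ n * C := fun ω => by
      refine (Finset.abs_sum_le_sum_abs _ _).trans ?_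
      calc _ ≤ ∑ i ∈ Finset.range n, C := Finset.sum_le_sum fun i _ => by
            rw [abs_mul, abs_boolSign, one_mul]; exact hC i ω
        _ = n * C := by simp
    have hJ : Measurable[coordsAlg {Sum.inl (Sum.inr ((x, n), x))}]
        fun ω : Sample k => boolSign (ω.1.2 ((x, n), x)) :=
      (measurable_of_countable boolSign).comp (measurable_sign rfl)
    have hdisj : Disjoint {Sum.inl (Sum.inr ((x, n), x))} (S ∪ T) := by
      rw [Set.disjoint_singleton_left, Set.mem_union, not_or]
      refine ⟨hx n, ?_⟩
      rintro ⟨i, hi, h⟩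
      simp only [Sum.inl.injEq, Sum.inr.injEq, Prod.mk.injEq, true_and, and_true] at h
      omega
    have hind : IndepFun (fun ω : Sample k => boolSign (ω.1.2 ((x, n), x)))
        (fun ω => W ω * D n ω) (sampleLaw k d π) :=
      indep_of_indep_of_le_left (indep_of_indep_of_le_right (indep_coordsAlg hdisj)
        (measurable_iff_comap_le.1 hWD)) (measurable_iff_comap_le.1 hJ)
    have hcross : ∫ ω : Sample k, boolSign (ω.1.2 ((x, n), x)) * (W ω * D n ω)
        ∂sampleLaw k d π = 0 := by
      rw [hind.integral_fun_mul_eq_mul_integral (hJm n).aestronglyMeasurable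
        (hWm'.mul (hDm n)).aestronglyMeasurable, integral_boolSign, zero_mul]
    have hi1 : Integrable (fun ω => W ω ^ 2) (sampleLaw k d π) := by
      refine Integrable.of_bound (hWm'.pow_const 2).aestronglyMeasurable ((n * C) ^ 2)
        (ae_of_all _ fun ω => ?_)
      rw [Real.norm_eq_abs, abs_pow]
      exact pow_le_pow_left₀ (abs_nonneg _) (hWb ω) 2
    have hi2 : Integrable (fun ω : Sample k => boolSign (ω.1.2 ((x, n), x)) * (W ω * D n ω))
        (sampleLaw k d π) := by
      refine Integrable.of_bound ((hJm n).mul (hWm'.mul (hDm n))).aestronglyMeasurable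
        (n * C * C) (ae_of_all _ fun ω => ?_)
      rw [Real.norm_eq_abs, abs_mul, abs_boolSign, one_mul, abs_mul]
      exact mul_le_mul (hWb ω) (hC n ω) (abs_nonneg _) (by positivity)
    have hi3 : Integrable (fun ω => D n ω ^ 2) (sampleLaw k d π) := by
      refine Integrable.of_bound ((hDm n).pow_const 2).aestronglyMeasurable (C ^ 2)
        (ae_of_all _ fun ω => ?_)
      rw [Real.norm_eq_abs, abs_pow]
      exact pow_le_pow_left₀ (abs_nonneg _) (hC n ω) 2
    have hexp : ∀ ω : Sample k,
        (∑ i ∈ Finset.range (n + 1), boolSign (ω.1.2 ((x, i), x)) * D i ω) ^ 2 =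
        W ω ^ 2 + 2 * (boolSign (ω.1.2 ((x, n), x)) * (W ω * D n ω)) + D n ω ^ 2 := fun ω => by
      rw [Finset.sum_range_succ]
      have h := boolSign_sq (ω.1.2 ((x, n), x))
      linear_combination D n ω ^ 2 * h
    simp_rw [hexp]
    have hi12 : Integrable (fun ω : Sample k => W ω ^ 2 +
        2 * (boolSign (ω.1.2 ((x, n), x)) * (W ω * D n ω))) (sampleLaw k d π) :=
      hi1.add (hi2.const_mul 2)
    rw [integral_add hi12 hi3, integral_add hi1 (hi2.const_mul 2),
      integral_const_mul, hcross, Finset.sum_range_succ, ← ih]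
    ring

/-- The second moment of a randomly signed sum over the child clauses of a variable. -/
theorem lintegral_sq_signed_sum_le {S : Set (Coord k)} {x : TVar k}
    (hx : ∀ i, Sum.inl (Sum.inr ((x, i), x)) ∉ S) (hx' : Sum.inl (Sum.inl x) ∉ S)
    {D : ℕ → Sample k → ℝ} (hD : ∀ n, Measurable[coordsAlg S] (D n)) {C : ℝ}
    (hC : ∀ n ω, |D n ω| ≤ C) {M : ℝ≥0∞}
    (hM : ∀ n, ∫⁻ ω, ENNReal.ofReal (D n ω ^ 2) ∂sampleLaw k d π ≤ M) :
    ∫⁻ ω, ENNReal.ofReal ((∑ i ∈ Finset.range (ω.1.1 x),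
      boolSign (ω.1.2 ((x, i), x)) * D i ω) ^ 2) ∂sampleLaw k d π ≤ ENNReal.ofReal d * M := by
  have hDm : ∀ i, Measurable (D i) := fun i => (hD i).mono (coordsAlg_le _) le_rfl
  have hJm : ∀ i, Measurable fun ω : Sample k => boolSign (ω.1.2 ((x, i), x)) := fun i =>
    (measurable_of_countable boolSign).comp (by fun_prop)
  refine lintegral_degree_le (x := x) (S := S ∪ {c | ∃ i, c = Sum.inl (Sum.inr ((x, i), x))})
    (H := fun n ω => ENNReal.ofReal ((∑ i ∈ Finset.range n,
      boolSign (ω.1.2 ((x, i), x)) * D i ω) ^ 2)) ?_ (fun n => ?_) fun n => ?_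
  · rw [Set.mem_union, not_or]
    exact ⟨hx', by simp⟩
  · refine ENNReal.measurable_ofReal.comp (Measurable.pow_const ?_ 2)
    refine Finset.measurable_fun_sum _ fun i _ => ?_
    refine Measurable.mul ?_ ((hD i).mono (coordsAlg_mono Set.subset_union_left) le_rfl)
    exact (measurable_of_countable boolSign).comp (measurable_sign (Or.inr ⟨i, rfl⟩))
  · have hint : ∀ i, Integrable (fun ω => D i ω ^ 2) (sampleLaw k d π) := fun i => by
      refine Integrable.of_bound ((hDm i).pow_const 2).aestronglyMeasurable (C ^ 2)
        (ae_of_all _ fun ω => ?_)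
      rw [Real.norm_eq_abs, abs_pow]
      exact pow_le_pow_left₀ (abs_nonneg _) (hC i ω) 2
    rw [← ofReal_integral_eq_lintegral_ofReal]
    · rw [integral_sq_sum_sign hx hD hC, ENNReal.ofReal_sum_of_nonneg
        fun i _ => integral_nonneg fun ω => sq_nonneg _]
      calc _ ≤ ∑ i ∈ Finset.range n, M := Finset.sum_le_sum fun i _ => by
            rw [ofReal_integral_eq_lintegral_ofReal (hint i) (ae_of_all _ fun ω => sq_nonneg _)]
            exact hM i
        _ = n * M := by simp
    · refine Integrable.of_bound (Measurable.pow_const (Finset.measurable_fun_sum _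
        fun i _ => (hJm i).mul (hDm i)) 2).aestronglyMeasurable ((n * C) ^ 2)
        (ae_of_all _ fun ω => ?_)
      rw [Real.norm_eq_abs, abs_pow]
      refine pow_le_pow_left₀ (abs_nonneg _) ?_ 2
      refine (Finset.abs_sum_le_sum_abs _ _).trans ?_
      calc _ ≤ ∑ i ∈ Finset.range n, C := Finset.sum_le_sum fun i _ => by
            rw [abs_mul, abs_boolSign, one_mul]; exact hC i ω
        _ = n * C := by simp
    · exact ae_of_all _ fun ω => sq_nonneg _

end Sums

/-! ### Subtrees, slim tails and contraction -/

/-- The variable to which a coordinate belongs: a sign belongs to the parent variable of its clause,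
an initial message to the variable that sends it, or to the parent of the clause that sends it. -/
def owner {k : ℕ} : Coord k → TVar k :=
  Sum.elim (Sum.elim id fun p => p.1.1) (Sum.elim (fun p => p.1.1) fun p => p.1)

/-- The coordinates belonging to the descendants of `x`, including `x` itself. -/
def subtree {k : ℕ} (x : TVar k) : Set (Coord k) := {c | x <:+ owner c}

/-- The coordinates on which the messages from the child clauses of `x` depend, up to their signs
at `x`. -/
def below {k : ℕ} (x : TVar k) : Set (Coord k) :=
  {c | ∃ p, c ∈ subtree (p :: x)} ∪ {c | ∃ i z, z ≠ x ∧ c = Sum.inl (Sum.inr ((x, i), z))}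

section Trees

variable {k : ℕ} {x : TVar k}

theorem degree_mem_subtree : Sum.inl (Sum.inl x) ∈ subtree x := List.suffix_refl x

theorem sign_mem_subtree (i : ℕ) (z : TVar k) : Sum.inl (Sum.inr ((x, i), z)) ∈ subtree x :=
  List.suffix_refl x

theorem init_mem_subtree (a : TClause k) : Sum.inr (Sum.inr (x, a)) ∈ subtree x :=
  List.suffix_refl x

theorem owner_ne_of_mem_subtree {p : ℕ × Fin (k - 1)} {c : Coord k} (h : c ∈ subtree (p :: x)) :
    owner c ≠ x := fun e => by
  have : p :: x <:+ x := e ▸ h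
  simpa using this.length_le

theorem degree_notMem_below : Sum.inl (Sum.inl x) ∉ below x := by
  rintro (⟨p, hp⟩ | ⟨i, z, -, h⟩)
  · exact owner_ne_of_mem_subtree hp rfl
  · simp at h

theorem sign_notMem_below (i : ℕ) : Sum.inl (Sum.inr ((x, i), x)) ∉ below x := by
  rintro (⟨p, hp⟩ | ⟨i, z, hz, h⟩)
  · exact owner_ne_of_mem_subtree hp rfl
  · simp only [Sum.inl.injEq, Sum.inr.injEq, Prod.mk.injEq] at h
    exact hz h.2.symm

theorem subtree_cons_subset_below (p : ℕ × Fin (k - 1)) : subtree (p :: x) ⊆ below x :=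
  fun _ hc => Or.inl ⟨p, hc⟩

theorem sign_mem_below (i : ℕ) (p : ℕ × Fin (k - 1)) :
    Sum.inl (Sum.inr ((x, i), p :: x)) ∈ below x := Or.inr ⟨i, _, cons_ne _ _, rfl⟩

theorem below_subset_subtree : below x ⊆ subtree x := by
  rintro c (⟨p, hp⟩ | ⟨i, z, -, rfl⟩)
  · exact (List.suffix_cons p x).trans hp
  · exact sign_mem_subtree i z

theorem disjoint_subtree_cons {p q : ℕ × Fin (k - 1)} (h : p ≠ q) :
    Disjoint (subtree (p :: x)) (subtree (q :: x)) := by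
  rw [Set.disjoint_left]
  intro c (hp : p :: x <:+ owner c) (hq : q :: x <:+ owner c)
  have := (List.suffix_of_suffix_length_le hp hq (by simp)).eq_of_length (by simp)
  exact h (List.cons.inj this).1

end Trees

theorem measurable_sum_range_comp {Ω E : Type*} [MeasurableSpace Ω] [MeasurableSpace E]
    [AddCommMonoid E] [MeasurableAdd₂ E] {N : Ω → ℕ} (hN : Measurable N)
    {h : ℕ → Ω → E} (hh : ∀ i, Measurable (h i)) :
    Measurable fun ω => ∑ i ∈ Finset.range (N ω), h i ω := by
  have h1 : Measurable fun p : ℕ × Ω => ∑ i ∈ Finset.range p.1, h i p.2 :=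
    measurable_from_prod_countable_right fun n => by
      simpa using Finset.measurable_fun_sum (Finset.range n) fun i _ => hh i
  exact h1.comp (hN.prodMk measurable_id)

/-- A family of random messages, one for each variable, each determined by the subtree of its
variable. -/
def IsAdapted {k : ℕ} (u : Sample k → TVar k → ℝ) : Prop :=
  ∀ x, Measurable[coordsAlg (subtree x)] fun ω => u ω x

theorem measurable_clauseLog (β : ℝ) : Measurable (clauseLog β) := by
  unfold clauseLog; fun_prop

theorem measurable_missProb {k : ℕ} {u : Sample k → TVar k → ℝ} (hu : IsAdapted u) (x : TVar k)
    (i : ℕ) : Measurable[coordsAlg (below x)] fun ω => missProb ω.1 (u ω) x i := by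
  refine Finset.measurable_fun_prod _ fun j _ => ?_
  have h1 : Measurable fun p : Bool × ℝ => oppProb p.1 p.2 :=
    measurable_from_prod_countable_right fun s => by cases s <;> simp [oppProb] <;> fun_prop
  exact h1.comp (Measurable.prodMk (measurable_sign (sign_mem_below i (i, j)))
    ((hu _).mono (coordsAlg_mono (subtree_cons_subset_below _)) le_rfl))

theorem isAdapted_signedSum {k : ℕ} {D : TVar k → ℕ → Sample k → ℝ}
    (hD : ∀ x i, Measurable[coordsAlg (below x)] (D x i)) :
    IsAdapted fun ω x => ∑ i ∈ Finset.range (ω.1.1 x),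
      boolSign (ω.1.2 ((x, i), x)) * D x i ω := by
  intro x
  refine @measurable_sum_range_comp _ _ (coordsAlg (subtree x)) _ _ _ _
    (measurable_degree degree_mem_subtree) _ fun i => ?_
  refine Measurable.mul ?_ ((hD x i).mono (coordsAlg_mono below_subset_subtree) le_rfl)
  exact (measurable_of_countable boolSign).comp (measurable_sign (sign_mem_subtree i x))

theorem IsAdapted.logOdds {k : ℕ} {u : Sample k → TVar k → ℝ} (hu : IsAdapted u) (β : ℝ) :
    IsAdapted fun ω => logOdds β ω.1 (u ω) :=
  isAdapted_signedSum (D := fun x i ω => clauseLog β (missProb ω.1 (u ω) x i))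
    fun x i => (measurable_clauseLog β).comp (measurable_missProb hu x i)

theorem IsAdapted.sigmoid {k : ℕ} {L : Sample k → TVar k → ℝ} (hL : IsAdapted L) :
    IsAdapted fun ω x => Real.sigmoid (L ω x) := fun x =>
  continuous_sigmoid.measurable.comp (hL x)

theorem IsAdapted.measurable {k : ℕ} {u : Sample k → TVar k → ℝ} (hu : IsAdapted u) (x : TVar k) :
    Measurable fun ω => u ω x := (hu x).mono (coordsAlg_le _) le_rfl

/-- The largest probability with which a literal of `x`, of either sign, is false under either of
two families of messages. -/
def worstProb {k : ℕ} (u u' : TVar k → ℝ) (x : TVar k) : ℝ :=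
  1 / 2 + max |u x - 1 / 2| |u' x - 1 / 2|

theorem oppProb_le_worstProb_left {k : ℕ} (s : Bool) (u u' : TVar k → ℝ) (x : TVar k) :
    oppProb s (u x) ≤ worstProb u u' x :=
  oppProb_le.trans (by unfold worstProb; gcongr; exact le_max_left _ _)

theorem oppProb_le_worstProb_right {k : ℕ} (s : Bool) (u u' : TVar k → ℝ) (x : TVar k) :
    oppProb s (u' x) ≤ worstProb u u' x :=
  oppProb_le.trans (by unfold worstProb; gcongr; exact le_max_right _ _)

theorem IsAdapted.measurable_comp₂ {k : ℕ} {u u' : Sample k → TVar k → ℝ} (hu : IsAdapted u)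
    (hu' : IsAdapted u') (x : TVar k) {f : ℝ → ℝ → ℝ≥0∞}
    (hf : Measurable fun q : ℝ × ℝ => f q.1 q.2) :
    Measurable[coordsAlg (subtree x)] fun ω => f (u ω x) (u' ω x) := by
  have h : Measurable[coordsAlg (subtree x)] fun ω => (u ω x, u' ω x) :=
    Measurable.prodMk (hu x) (hu' x)
  exact hf.comp h

theorem measurable_worstProb {k : ℕ} {u u' : Sample k → TVar k → ℝ} (hu : IsAdapted u)
    (hu' : IsAdapted u') (x : TVar k) :
    Measurable[coordsAlg (subtree x)] fun ω => ENNReal.ofReal (worstProb (u ω) (u' ω) x ^ 2) :=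
  hu.measurable_comp₂ hu' x
    (f := fun a b => ENNReal.ofReal ((1 / 2 + max |a - 1 / 2| |b - 1 / 2|) ^ 2))
    (ENNReal.measurable_ofReal.comp (Continuous.measurable (by fun_prop)))

section Estimates

variable {k : ℕ} {d : ℝ} {π : Measure unitInterval} [IsProbabilityMeasure π]
  {u u' : Sample k → TVar k → ℝ} {β δ : ℝ}

/-- Messages with slim tails make a literal false with probability close to `1/2`. -/
theorem lintegral_worstProb_le (hu : IsAdapted u) (hu' : IsAdapted u')
    (hu1 : ∀ ω x, 0 ≤ u ω x ∧ u ω x ≤ 1) (hu1' : ∀ ω x, 0 ≤ u' ω x ∧ u' ω x ≤ 1)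
    (hδ0 : 0 ≤ δ) (hδ : δ ≤ 1 / 64) (x : TVar k)
    (hs : sampleLaw k d π {ω | δ ≤ |u ω x - 1 / 2|} ≤ ENNReal.ofReal δ)
    (hs' : sampleLaw k d π {ω | δ ≤ |u' ω x - 1 / 2|} ≤ ENNReal.ofReal δ) :
    ∫⁻ ω, ENNReal.ofReal (worstProb (u ω) (u' ω) x ^ 2) ∂sampleLaw k d π ≤
      ENNReal.ofReal (3 / 10) := by
  set A := {ω | δ ≤ |u ω x - 1 / 2|}
  set A' := {ω | δ ≤ |u' ω x - 1 / 2|}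
  have hA : MeasurableSet A :=
    measurableSet_le measurable_const ((hu.measurable x).sub_const _).norm
  have hA' : MeasurableSet A' :=
    measurableSet_le measurable_const ((hu'.measurable x).sub_const _).norm
  have hpt : ∀ ω, ENNReal.ofReal (worstProb (u ω) (u' ω) x ^ 2) ≤
      ENNReal.ofReal ((1 / 2 + δ) ^ 2) + A.indicator 1 ω + A'.indicator 1 ω := by
    intro ω
    have h1 : |u ω x - 1 / 2| ≤ 1 / 2 := abs_le.2 ⟨by linarith [hu1 ω x], by linarith [hu1 ω x]⟩
    have h1' : |u' ω x - 1 / 2| ≤ 1 / 2 :=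
      abs_le.2 ⟨by linarith [hu1' ω x], by linarith [hu1' ω x]⟩
    have h0 : 0 ≤ max |u ω x - 1 / 2| |u' ω x - 1 / 2| := le_max_of_le_left (abs_nonneg _)
    have hle1 : ENNReal.ofReal (worstProb (u ω) (u' ω) x ^ 2) ≤ 1 := by
      rw [← ENNReal.ofReal_one]
      refine ENNReal.ofReal_le_ofReal (pow_le_one₀ ?_ ?_) <;> unfold worstProb
      · positivity
      · linarith [max_le h1 h1']
    by_cases ha : ω ∈ A
    · rw [Set.indicator_of_mem ha]
      exact hle1.trans (le_add_right le_add_self)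
    by_cases ha' : ω ∈ A'
    · rw [Set.indicator_of_mem ha']
      exact hle1.trans le_add_self
    rw [Set.indicator_of_notMem ha, Set.indicator_of_notMem ha', add_zero, add_zero]
    refine ENNReal.ofReal_le_ofReal (pow_le_pow_left₀ (by unfold worstProb; positivity) ?_ 2)
    unfold worstProb
    gcongr
    exact max_le (not_le.1 ha).le (not_le.1 ha').le
  refine (lintegral_mono hpt).trans ?_
  rw [lintegral_add_right _ (measurable_one.indicator hA'),
    lintegral_add_right _ (measurable_one.indicator hA), lintegral_indicator_one hA,
    lintegral_indicator_one hA', lintegral_const, measure_univ, mul_one]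
  calc _ ≤ ENNReal.ofReal ((1 / 2 + δ) ^ 2) + ENNReal.ofReal δ + ENNReal.ofReal δ := by gcongr
    _ = ENNReal.ofReal ((1 / 2 + δ) ^ 2 + δ + δ) := by
      rw [ENNReal.ofReal_add (by positivity) hδ0, ENNReal.ofReal_add (by positivity) hδ0]
    _ ≤ _ := ENNReal.ofReal_le_ofReal (by nlinarith)

theorem lintegral_missProb_sq_le (hu : IsAdapted u) (hu1 : ∀ ω x, 0 ≤ u ω x ∧ u ω x ≤ 1)
    (hδ0 : 0 ≤ δ) (hδ : δ ≤ 1 / 64)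
    (hs : ∀ x, sampleLaw k d π {ω | δ ≤ |u ω x - 1 / 2|} ≤ ENNReal.ofReal δ) (x : TVar k) (i : ℕ) :
    ∫⁻ ω, ENNReal.ofReal (missProb ω.1 (u ω) x i ^ 2) ∂sampleLaw k d π ≤
      ENNReal.ofReal ((3 / 10) ^ (k - 1)) := by
  calc _ ≤ ∫⁻ ω, ∏ j : Fin (k - 1), ENNReal.ofReal (worstProb (u ω) (u ω) ((i, j) :: x) ^ 2)
          ∂sampleLaw k d π := by
        refine lintegral_mono fun ω => ?_
        rw [missProb, ← Finset.prod_pow, ENNReal.ofReal_prod_of_nonneg fun j _ => sq_nonneg _]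
        gcongr with j
        · exact oppProb_nonneg (hu1 _ _).1 (hu1 _ _).2
        · exact oppProb_le_worstProb_left _ _ _ _
    _ = ∏ j : Fin (k - 1), ∫⁻ ω, ENNReal.ofReal (worstProb (u ω) (u ω) ((i, j) :: x) ^ 2)
          ∂sampleLaw k d π :=
        lintegral_prod_of_disjoint _ (S := fun j => subtree ((i, j) :: x))
          (fun j l h => disjoint_subtree_cons (by simpa using h))
          fun j => measurable_worstProb hu hu _
    _ ≤ ∏ j : Fin (k - 1), ENNReal.ofReal (3 / 10) :=
        Finset.prod_le_prod' fun j _ =>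
          lintegral_worstProb_le hu hu hu1 hu1 hδ0 hδ _ (hs _) (hs _)
    _ = _ := by simp [ENNReal.ofReal_pow (show (0 : ℝ) ≤ 3 / 10 by norm_num)]

/-- Slim tails are preserved: the log-odds are a signed sum of many small terms, to which
Chebyshev's inequality applies once the rare large terms are cut off. -/
theorem measure_le_abs_logOdds_le (hd : 0 ≤ d) (hβ : 0 ≤ β) (hu : IsAdapted u)
    (hu1 : ∀ ω x, 0 ≤ u ω x ∧ u ω x ≤ 1) (hδ0 : 0 < δ) (hδ : δ ≤ 1 / 64)
    (hs : ∀ x, sampleLaw k d π {ω | δ ≤ |u ω x - 1 / 2|} ≤ ENNReal.ofReal δ)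
    (hk : 8 * d * (3 / 10) ^ (k - 1) ≤ δ ^ 3) (x : TVar k) :
    sampleLaw k d π {ω | δ ≤ |logOdds β ω.1 (u ω) x|} ≤ ENNReal.ofReal δ := by
  set P := sampleLaw k d π
  set p : ℕ → Sample k → ℝ := fun i ω => missProb ω.1 (u ω) x i with hp
  have hpm : ∀ i, Measurable[coordsAlg (below x)] (p i) := measurable_missProb hu x
  have hp0 : ∀ i ω, 0 ≤ p i ω := fun i ω => missProb_nonneg _ (hu1 ω) _ _
  have hp1 : ∀ i ω, p i ω ≤ 1 := fun i ω => missProb_le_one _ (hu1 ω) _ _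
  set D : ℕ → Sample k → ℝ := fun i ω => min (clauseLog β (p i ω)) 1 with hD
  have hDm : ∀ i, Measurable[coordsAlg (below x)] (D i) := fun i =>
    ((measurable_clauseLog β).comp (hpm i)).min measurable_const
  have hD0 : ∀ i ω, 0 ≤ D i ω := fun i ω =>
    le_min (clauseLog_nonneg hβ (hp0 i ω) (hp1 i ω)) zero_le_one
  have hDp : ∀ i ω, D i ω ^ 2 ≤ 4 * p i ω ^ 2 := fun i ω => by
    have h := pow_le_pow_left₀ (hD0 i ω) (min_clauseLog_one_le hβ (hp0 i ω)) 2
    linarith [mul_pow 2 (p i ω) 2]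
  have hmom : ∀ i, ∫⁻ ω, ENNReal.ofReal (4 * p i ω ^ 2) ∂P ≤
      ENNReal.ofReal (4 * (3 / 10) ^ (k - 1)) := fun i => by
    have h4 : (0 : ℝ) ≤ 4 := by norm_num
    simp_rw [ENNReal.ofReal_mul h4]
    rw [lintegral_const_mul']
    · gcongr
      exact lintegral_missProb_sq_le hu hu1 hδ0.le hδ hs x i
    · simp
  set W : Sample k → ℝ := fun ω => ∑ i ∈ Finset.range (ω.1.1 x),
    boolSign (ω.1.2 ((x, i), x)) * D i ω with hW
  set H : Sample k → ℝ≥0∞ := fun ω => ∑ i ∈ Finset.range (ω.1.1 x),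
    ENNReal.ofReal (4 * p i ω ^ 2) with hH
  have hN : Measurable fun ω : Sample k => ω.1.1 x := by fun_prop
  have hWm : Measurable W := by
    refine measurable_sum_range_comp hN fun i => Measurable.mul ?_ ((hDm i).mono
      (coordsAlg_le _) le_rfl)
    exact (measurable_of_countable boolSign).comp (by fun_prop)
  have hHm : Measurable H := measurable_sum_range_comp hN fun i => ENNReal.measurable_ofReal.comp
    ((((hpm i).mono (coordsAlg_le _) le_rfl).pow_const 2).const_mul 4)
  have hWint : ∫⁻ ω, ENNReal.ofReal (W ω ^ 2) ∂P ≤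
      ENNReal.ofReal d * ENNReal.ofReal (4 * (3 / 10) ^ (k - 1)) :=
    lintegral_sq_signed_sum_le sign_notMem_below degree_notMem_below hDm (C := 1)
      (fun i ω => by rw [abs_of_nonneg (hD0 i ω)]; exact min_le_right _ _)
      fun i => (lintegral_mono fun ω => ENNReal.ofReal_le_ofReal (hDp i ω)).trans (hmom i)
  have hHint : ∫⁻ ω, H ω ∂P ≤ ENNReal.ofReal d * ENNReal.ofReal (4 * (3 / 10) ^ (k - 1)) := by
    have hm : ∀ i, Measurable[coordsAlg (below x)] fun ω => ENNReal.ofReal (4 * p i ω ^ 2) :=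
      fun i => ENNReal.measurable_ofReal.comp (((hpm i).pow_const 2).const_mul 4)
    refine lintegral_degree_le degree_notMem_below
      (H := fun n ω => ∑ i ∈ Finset.range n, ENNReal.ofReal (4 * p i ω ^ 2))
      (fun n => Finset.measurable_fun_sum _ fun i _ => hm i) fun n => ?_
    rw [lintegral_finsetSum _ fun i _ => (hm i).mono (coordsAlg_le _) le_rfl]
    calc _ ≤ ∑ i ∈ Finset.range n, ENNReal.ofReal (4 * (3 / 10) ^ (k - 1)) :=
          Finset.sum_le_sum fun i _ => hmom i
      _ = _ := by simp
  -- either some clause was cut off, which already makes its term in `H` at least `1`, or the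
  -- log-odds equal the truncated sum `W`
  have hsub : {ω | δ ≤ |logOdds β ω.1 (u ω) x|} ⊆
      {ω | ENNReal.ofReal (δ ^ 2) ≤ ENNReal.ofReal (W ω ^ 2)} ∪
      {ω | ENNReal.ofReal (δ ^ 2) ≤ H ω} := by
    intro ω hω
    by_cases hbig : ∃ i ∈ Finset.range (ω.1.1 x), 1 < clauseLog β (p i ω)
    · right
      obtain ⟨i, hi, h⟩ := hbig
      have h1 : (1 : ℝ) ≤ 4 * p i ω ^ 2 := by
        have := hDp i ω
        rw [hD] at this
        simp only [min_eq_right h.le] at this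
        linarith
      calc ENNReal.ofReal (δ ^ 2) ≤ ENNReal.ofReal (4 * p i ω ^ 2) :=
            ENNReal.ofReal_le_ofReal (by nlinarith)
        _ ≤ H ω := Finset.single_le_sum (f := fun i => ENNReal.ofReal (4 * p i ω ^ 2))
            (fun _ _ => zero_le) hi
    · left
      push Not at hbig
      have hWL : W ω = logOdds β ω.1 (u ω) x := Finset.sum_congr rfl fun i hi => by
        simp only [hD, min_eq_left (hbig i hi)]
        rfl
      have h2 : δ ≤ |W ω| := hWL ▸ hω
      refine ENNReal.ofReal_le_ofReal ?_
      rw [← sq_abs (W ω)]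
      exact pow_le_pow_left₀ hδ0.le h2 2
  have hδ2 : ENNReal.ofReal (δ ^ 2) ≠ 0 := by
    rw [ne_eq, ENNReal.ofReal_eq_zero, not_le]; positivity
  have hfin : ENNReal.ofReal (δ ^ 2) * P {ω | δ ≤ |logOdds β ω.1 (u ω) x|} ≤
      ENNReal.ofReal (δ ^ 2) * ENNReal.ofReal δ := by
    calc _ ≤ ENNReal.ofReal (δ ^ 2) * (P {ω | ENNReal.ofReal (δ ^ 2) ≤ ENNReal.ofReal (W ω ^ 2)} +
          P {ω | ENNReal.ofReal (δ ^ 2) ≤ H ω}) := by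
          gcongr
          exact (measure_mono hsub).trans (measure_union_le _ _)
      _ ≤ ENNReal.ofReal d * ENNReal.ofReal (4 * (3 / 10) ^ (k - 1)) +
          ENNReal.ofReal d * ENNReal.ofReal (4 * (3 / 10) ^ (k - 1)) := by
          rw [mul_add]
          exact add_le_add ((mul_meas_ge_le_lintegral
            (ENNReal.measurable_ofReal.comp (hWm.pow_const 2)) _).trans hWint)
            ((mul_meas_ge_le_lintegral hHm _).trans hHint)
      _ = ENNReal.ofReal (8 * d * (3 / 10) ^ (k - 1)) := by
          rw [← ENNReal.ofReal_mul hd, ← ENNReal.ofReal_add (by positivity) (by positivity)]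
          congr 1
          ring
      _ ≤ _ := by
          rw [← ENNReal.ofReal_mul (by positivity)]
          exact ENNReal.ofReal_le_ofReal (hk.trans_eq (by ring))
  exact (ENNReal.mul_le_mul_iff_right hδ2 ENNReal.ofReal_ne_top).1 hfin

/-- Because of the random signs at `x`, the mean squared change of the log-odds is at most the mean
number of child clauses times the mean squared change of a single clause. -/
theorem lintegral_sq_logOdds_sub_le (hβ : 0 ≤ β) (hu : IsAdapted u) (hu' : IsAdapted u')
    (hu1 : ∀ ω x, 0 ≤ u ω x ∧ u ω x ≤ 1) (hu1' : ∀ ω x, 0 ≤ u' ω x ∧ u' ω x ≤ 1)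
    {M : ℝ≥0∞} (x : TVar k)
    (hM : ∀ i, ∫⁻ ω, ENNReal.ofReal ((clauseLog β (missProb ω.1 (u ω) x i) -
      clauseLog β (missProb ω.1 (u' ω) x i)) ^ 2) ∂sampleLaw k d π ≤ M) :
    ∫⁻ ω, ENNReal.ofReal ((logOdds β ω.1 (u ω) x - logOdds β ω.1 (u' ω) x) ^ 2)
      ∂sampleLaw k d π ≤ ENNReal.ofReal d * M := by
  have h := lintegral_sq_signed_sum_le (π := π) (d := d) (x := x) sign_notMem_below
    degree_notMem_below
    (D := fun i ω => clauseLog β (missProb ω.1 (u ω) x i) - clauseLog β (missProb ω.1 (u' ω) x i))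
    (fun i => ((measurable_clauseLog β).comp (measurable_missProb hu x i)).sub
      ((measurable_clauseLog β).comp (measurable_missProb hu' x i))) (C := β)
    (fun i ω => by
      have a1 := missProb_nonneg ω.1 (hu1 ω) x i
      have a2 := missProb_le_one ω.1 (hu1 ω) x i
      have b1 := missProb_nonneg ω.1 (hu1' ω) x i
      have b2 := missProb_le_one ω.1 (hu1' ω) x i
      have c1 := clauseLog_nonneg hβ a1 a2
      have c2 := clauseLog_le hβ a2
      have d1 := clauseLog_nonneg hβ b1 b2
      have d2 := clauseLog_le hβ b2
      exact abs_le.2 ⟨by linarith, by linarith⟩) hM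
  refine le_of_eq_of_le (lintegral_congr fun ω => ?_) h
  simp only [logOdds, ← Finset.sum_sub_distrib, mul_sub]

/-- A bound for arbitrary messages, finite even when they take the values `0` and `1`. -/
theorem lintegral_sq_logOdds_sub_le_sq (hβ : 0 ≤ β) (hu : IsAdapted u) (hu' : IsAdapted u')
    (hu1 : ∀ ω x, 0 ≤ u ω x ∧ u ω x ≤ 1) (hu1' : ∀ ω x, 0 ≤ u' ω x ∧ u' ω x ≤ 1) (x : TVar k) :
    ∫⁻ ω, ENNReal.ofReal ((logOdds β ω.1 (u ω) x - logOdds β ω.1 (u' ω) x) ^ 2)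
      ∂sampleLaw k d π ≤ ENNReal.ofReal d * ENNReal.ofReal (β ^ 2) := by
  refine lintegral_sq_logOdds_sub_le hβ hu hu' hu1 hu1' x fun i => ?_
  refine (lintegral_mono (g := fun _ => ENNReal.ofReal (β ^ 2)) fun ω =>
    ENNReal.ofReal_le_ofReal ?_).trans_eq (by simp)
  have a1 := missProb_nonneg ω.1 (hu1 ω) x i
  have a2 := missProb_le_one ω.1 (hu1 ω) x i
  have b1 := missProb_nonneg ω.1 (hu1' ω) x i
  have b2 := missProb_le_one ω.1 (hu1' ω) x i
  have c1 := clauseLog_nonneg hβ a1 a2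
  have c2 := clauseLog_le hβ a2
  have d1 := clauseLog_nonneg hβ b1 b2
  have d2 := clauseLog_le hβ b2
  exact sq_le_sq' (by linarith) (by linarith)

/-- Belief Propagation contracts the mean squared distance of two families of log-odds with slim
tails. -/
theorem lintegral_sq_logOdds_sub_le_mul {L L' : Sample k → TVar k → ℝ} (hβ : 0 ≤ β)
    (hL : IsAdapted L) (hL' : IsAdapted L') (hδ0 : 0 ≤ δ) (hδ : δ ≤ 1 / 64)
    (hs : ∀ x, sampleLaw k d π {ω | δ ≤ |Real.sigmoid (L ω x) - 1 / 2|} ≤ ENNReal.ofReal δ)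
    (hs' : ∀ x, sampleLaw k d π {ω | δ ≤ |Real.sigmoid (L' ω x) - 1 / 2|} ≤ ENNReal.ofReal δ)
    {M : ℝ≥0∞}
    (hM : ∀ x, ∫⁻ ω, ENNReal.ofReal ((L ω x - L' ω x) ^ 2) ∂sampleLaw k d π ≤ M) (x : TVar k) :
    ∫⁻ ω, ENNReal.ofReal ((logOdds β ω.1 (fun y => Real.sigmoid (L ω y)) x -
      logOdds β ω.1 (fun y => Real.sigmoid (L' ω y)) x) ^ 2) ∂sampleLaw k d π ≤
      ENNReal.ofReal d * (ENNReal.ofReal ((k - 1 : ℕ) ^ 2 * (3 / 10) ^ (k - 2)) * M) := by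
  have h1 : ∀ (L : Sample k → TVar k → ℝ) ω x,
      0 ≤ Real.sigmoid (L ω x) ∧ Real.sigmoid (L ω x) ≤ 1 := fun L ω x =>
    ⟨Real.sigmoid_nonneg _, Real.sigmoid_le_one _⟩
  set u : Sample k → TVar k → ℝ := fun ω y => Real.sigmoid (L ω y) with hu
  set u' : Sample k → TVar k → ℝ := fun ω y => Real.sigmoid (L' ω y) with hu'
  have hua : IsAdapted u := hL.sigmoid
  have hua' : IsAdapted u' := hL'.sigmoid
  refine lintegral_sq_logOdds_sub_le hβ hua hua' (h1 L) (h1 L') x fun i => ?_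
  set w : Fin (k - 1) → Sample k → ℝ≥0∞ := fun l ω =>
    ENNReal.ofReal (worstProb (u ω) (u' ω) ((i, l) :: x) ^ 2) with hw
  set e : Fin (k - 1) → Sample k → ℝ≥0∞ := fun j ω =>
    ENNReal.ofReal ((L ω ((i, j) :: x) - L' ω ((i, j) :: x)) ^ 2) with he
  have hwm : ∀ l, Measurable[coordsAlg (subtree ((i, l) :: x))] (w l) := fun l =>
    measurable_worstProb hua hua' _
  have hem : ∀ l, Measurable[coordsAlg (subtree ((i, l) :: x))] (e l) := fun l =>
    ENNReal.measurable_ofReal.comp (((hL _).sub (hL' _)).pow_const 2)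
  have hpt : ∀ ω : Sample k, ENNReal.ofReal ((clauseLog β (missProb ω.1 (u ω) x i) -
      clauseLog β (missProb ω.1 (u' ω) x i)) ^ 2) ≤
      (k - 1 : ℕ) * ∑ j, e j ω * ∏ l ∈ Finset.univ.erase j, w l ω := by
    intro ω
    have := sq_clauseLog_prod_sub_le
      (fun j : Fin (k - 1) => -boolSign (ω.1.2 ((x, i), (i, j) :: x)) * L ω ((i, j) :: x))
      (fun j : Fin (k - 1) => -boolSign (ω.1.2 ((x, i), (i, j) :: x)) * L' ω ((i, j) :: x))
      (fun j => worstProb (u ω) (u' ω) ((i, j) :: x))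
      (fun j => by rw [← oppProb_sigmoid]; exact oppProb_le_worstProb_left _ (u ω) (u' ω) _)
      (fun j => by rw [← oppProb_sigmoid]; exact oppProb_le_worstProb_right _ (u ω) (u' ω) _) hβ
    simp only [← oppProb_sigmoid, ← mul_sub, mul_pow, neg_sq, boolSign_sq, one_mul,
      Fintype.card_fin] at this
    refine (ENNReal.ofReal_le_ofReal this).trans_eq ?_
    rw [ENNReal.ofReal_mul (by positivity), ENNReal.ofReal_natCast,
      ENNReal.ofReal_sum_of_nonneg fun j _ => by positivity]
    congr 1
    refine Finset.sum_congr rfl fun j _ => ?_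
    rw [ENNReal.ofReal_mul (by positivity), ENNReal.ofReal_prod_of_nonneg fun l _ => sq_nonneg _]
  have hint : ∀ j, ∫⁻ ω, e j ω * ∏ l ∈ Finset.univ.erase j, w l ω ∂sampleLaw k d π ≤
      M * ENNReal.ofReal ((3 / 10) ^ (k - 2)) := by
    intro j
    have hdisj : Disjoint (subtree ((i, j) :: x))
        (⋃ l ∈ Finset.univ.erase j, subtree ((i, l) :: x)) := by
      rw [Set.disjoint_iUnion₂_right]
      intro l hl
      exact disjoint_subtree_cons (by simpa using (Finset.ne_of_mem_erase hl).symm)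
    rw [lintegral_mul_of_disjoint hdisj (hem j) (Finset.measurable_fun_prod _ fun l hl =>
      (hwm l).mono (coordsAlg_mono (Set.subset_biUnion_of_mem
        (u := fun l => subtree ((i, l) :: x)) hl)) le_rfl),
      lintegral_prod_of_disjoint _ (S := fun l => subtree ((i, l) :: x))
        (fun j l h => disjoint_subtree_cons (by simpa using h)) hwm]
    refine mul_le_mul' (hM _) ?_
    calc _ ≤ ∏ l ∈ Finset.univ.erase j, ENNReal.ofReal (3 / 10) :=
          Finset.prod_le_prod' fun l _ =>
            lintegral_worstProb_le hua hua' (h1 L) (h1 L') hδ0 hδ _ (hs _) (hs' _)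
      _ = _ := by
        rw [Finset.prod_const, Finset.card_erase_of_mem (Finset.mem_univ j), Finset.card_univ,
          Fintype.card_fin, ENNReal.ofReal_pow (by norm_num)]
        rfl
  calc _ ≤ ∫⁻ ω, (k - 1 : ℕ) * ∑ j, e j ω * ∏ l ∈ Finset.univ.erase j, w l ω
          ∂sampleLaw k d π := lintegral_mono hpt
    _ = (k - 1 : ℕ) * ∑ j, ∫⁻ ω, e j ω * ∏ l ∈ Finset.univ.erase j, w l ω
          ∂sampleLaw k d π := by
        rw [lintegral_const_mul' _ _ (by simp), lintegral_finsetSum]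
        exact fun j _ => ((hem j).mono (coordsAlg_le _) le_rfl).mul
          (Finset.measurable_fun_prod _ fun l _ => (hwm l).mono (coordsAlg_le _) le_rfl)
    _ ≤ (k - 1 : ℕ) * ∑ j : Fin (k - 1), M * ENNReal.ofReal ((3 / 10) ^ (k - 2)) := by
        gcongr with j
        exact hint j
    _ = _ := by
        rw [Finset.sum_const, Finset.card_univ, Fintype.card_fin, nsmul_eq_mul,
          ENNReal.ofReal_mul (by positivity), ENNReal.ofReal_pow (Nat.cast_nonneg _),
          ENNReal.ofReal_natCast]
        ring

end Estimates

/-! ### The first moment bound on the satisfiability threshold -/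

/-- An assignment violates a clause for exactly one of the `2^k` choices of its signs. -/
theorem card_satisfiedBy {k n : ℕ} (σ : Fin n → Bool) :
    (Nat.card {c : KClause k n // c.SatisfiedBy σ} : ℝ) =
      (1 - (1 / 2) ^ k) * Nat.card (KClause k n) := by
  classical
  have h1 : Nat.card {c : KClause k n // ¬ c.SatisfiedBy σ} = Nat.card (Fin k ↪ Fin n) := by
    refine Nat.card_congr ⟨fun c => c.1.1, fun e => ⟨(e, fun j => !σ (e j)), ?_⟩, ?_, fun e => rfl⟩
    · rintro ⟨j, hj⟩
      simp at hj
    · rintro ⟨⟨e, s⟩, hc⟩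
      simp only [Subtype.mk.injEq, Prod.mk.injEq, true_and]
      funext j
      have : ¬ σ (e j) = s j := fun h => hc ⟨j, h⟩
      revert this
      cases σ (e j) <;> cases s j <;> simp
  have h2 : Nat.card (KClause k n) = Nat.card (Fin k ↪ Fin n) * 2 ^ k := by
    simp
  have h3 : Nat.card {c : KClause k n // c.SatisfiedBy σ} +
      Nat.card {c : KClause k n // ¬ c.SatisfiedBy σ} = Nat.card (KClause k n) := by
    rw [← Nat.card_sum]
    exact Nat.card_congr (Equiv.sumCompl _)
  rw [h1] at h3
  have h3' : (Nat.card {c : KClause k n // c.SatisfiedBy σ} : ℝ) + Nat.card (Fin k ↪ Fin n) =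
    Nat.card (KClause k n) := by exact_mod_cast h3
  rw [h2] at h3' ⊢
  push_cast at h3' ⊢
  have h4 : (1 / 2 : ℝ) ^ k * 2 ^ k = 1 := by rw [← mul_pow]; norm_num
  linear_combination h3' + (Nat.card (Fin k ↪ Fin n) : ℝ) * h4

/-- The union bound over assignments. -/
theorem satFraction_le {k n : ℕ} (hkn : k ≤ n) (m : ℕ) :
    satFraction k n m ≤ 2 ^ n * (1 - (1 / 2) ^ k) ^ m := by
  classical
  have hcard : Nat.card {Φ : Fin m → KClause k n //
      ∃ σ : Fin n → Bool, ∀ i, (Φ i).SatisfiedBy σ} ≤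
      Nat.card (Σ σ : Fin n → Bool, Fin m → {c : KClause k n // c.SatisfiedBy σ}) := by
    refine Nat.card_le_card_of_injective
      (fun Φ => ⟨Φ.2.choose, fun i => ⟨Φ.1 i, Φ.2.choose_spec i⟩⟩) fun Φ Ψ h => ?_
    have := congrArg (fun z : (Σ σ : Fin n → Bool, Fin m → {c : KClause k n // c.SatisfiedBy σ}) =>
      fun i => (z.2 i).1) h
    exact Subtype.ext this
  rw [Nat.card_sigma] at hcard
  simp only [Nat.card_fun, Nat.card_eq_fintype_card (α := Fin m), Fintype.card_fin] at hcard
  have hpos : 0 < (Nat.card (KClause k n) : ℝ) := by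
    have : Nonempty (KClause k n) := ⟨(Fin.castLEEmb hkn, fun _ => true)⟩
    exact_mod_cast Nat.card_pos
  have hcard' : (Nat.card {Φ : Fin m → KClause k n //
      ∃ σ : Fin n → Bool, ∀ i, (Φ i).SatisfiedBy σ} : ℝ) ≤
      2 ^ n * ((1 - (1 / 2) ^ k) * Nat.card (KClause k n)) ^ m := by
    refine (Nat.cast_le.2 hcard).trans_eq ?_
    push_cast
    simp_rw [card_satisfiedBy]
    simp
  unfold satFraction
  rw [Nat.card_fun, Nat.card_eq_fintype_card (α := Fin m), Fintype.card_fin]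
  push_cast
  rw [div_le_iff₀ (by positivity)]
  refine hcard'.trans_eq ?_
  rw [mul_pow]
  ring

theorem integral_pow_poissonMeasure (r : NNReal) (q : ℝ) :
    ∫ m, q ^ m ∂poissonMeasure r = Real.exp (-(r * (1 - q))) := by
  rw [integral_poissonMeasure]
  have h : ∀ m : ℕ, (Real.exp (-r) * r ^ m / m.factorial) • q ^ m =
      Real.exp (-r) * ((r * q) ^ m / m.factorial) := fun m => by
    rw [smul_eq_mul, mul_pow]; ring
  simp_rw [h]
  have hexp : ∑' m : ℕ, (r * q) ^ m / (m.factorial : ℝ) = Real.exp (r * q) := by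
    rw [Real.exp_eq_exp_ℝ, NormedSpace.exp_eq_tsum_div]
  rw [tsum_mul_left, hexp, ← Real.exp_add]
  congr 1
  ring

theorem satFraction_nonneg (k n m : ℕ) : 0 ≤ satFraction k n m := by
  unfold satFraction; positivity

/-- The first moment bound on the probability of satisfiability. -/
theorem satProb_le {k n : ℕ} (hkn : k ≤ n) {d : ℝ} (hd : 0 ≤ d) :
    satProb k d n ≤ 2 ^ n * Real.exp (-(d * n / k * (1 / 2) ^ k)) := by
  have hq0 : (0 : ℝ) ≤ 1 - (1 / 2) ^ k := by
    have : (1 / 2 : ℝ) ^ k ≤ 1 := pow_le_one₀ (by norm_num) (by norm_num)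
    linarith
  have hq1 : (1 : ℝ) - (1 / 2) ^ k ≤ 1 := by
    have : (0 : ℝ) < (1 / 2) ^ k := by positivity
    linarith
  unfold satProb
  calc _ ≤ ∫ m, (2 : ℝ) ^ n * (1 - (1 / 2) ^ k) ^ m ∂poissonMeasure (d * n / k).toNNReal := by
        refine integral_mono_of_nonneg (ae_of_all _ fun m => satFraction_nonneg k n m) ?_
          (ae_of_all _ fun m => satFraction_le hkn m)
        refine Integrable.of_bound (measurable_of_countable _).aestronglyMeasurable (2 ^ n)
          (ae_of_all _ fun m => ?_)
        rw [Real.norm_of_nonneg (by positivity)]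
        exact mul_le_of_le_one_right (by positivity) (pow_le_one₀ hq0 hq1)
    _ = _ := by
        rw [integral_const_mul, integral_pow_poissonMeasure, Real.coe_toNNReal _ (by positivity)]
        congr 3
        ring

theorem satThreshold_le {k : ℕ} (hk : 0 < k) : satThreshold k ≤ k * 2 ^ k := by
  refine Real.sSup_le ?_ (by positivity)
  rintro d ⟨hd, hlim⟩
  by_contra! hlt
  have hk' : (0 : ℝ) < k := by exact_mod_cast hk
  have hb : ∀ᶠ n : ℕ in atTop, satProb k d n ≤ (2 * Real.exp (-1)) ^ n := by
    filter_upwards [eventually_ge_atTop k] with n hn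
    refine (satProb_le hn hd).trans ?_
    rw [mul_pow, ← Real.exp_nat_mul]
    gcongr
    have h1 : 1 ≤ d / k * (1 / 2) ^ k := by
      rw [one_div, inv_pow, ← div_eq_mul_inv, div_div, one_le_div (by positivity)]
      exact hlt.le
    have h2 : d * n / k * (1 / 2) ^ k = n * (d / k * (1 / 2) ^ k) := by ring
    rw [h2]
    nlinarith [Nat.cast_nonneg (α := ℝ) n]
  have he : 2 * Real.exp (-1) < 1 := by
    rw [Real.exp_neg, ← div_eq_mul_inv, div_lt_one (Real.exp_pos _)]
    exact lt_trans (by norm_num) Real.exp_one_gt_d9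
  have h0 := tendsto_pow_atTop_nhds_zero_of_lt_one (by positivity) he
  have := le_of_tendsto_of_tendsto hlim h0 hb
  linarith

/-- For large `k` all densities up to the threshold are small enough for slim tails to be
preserved and for Belief Propagation to contract. -/
theorem exists_large_k : ∃ k₀ : ℕ, 3 ≤ k₀ ∧ ∀ k : ℕ, k₀ ≤ k → ∀ d : ℝ, 0 < d →
    d ≤ satThreshold k →
      (2 : ℝ) ^ (-(k : ℝ) / 10) ≤ 1 / 64 ∧
      8 * d * (3 / 10) ^ (k - 1) ≤ ((2 : ℝ) ^ (-(k : ℝ) / 10)) ^ 3 ∧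
      d * ((k - 1 : ℕ) ^ 2 * (3 / 10) ^ (k - 2)) ≤ 1 / 2 := by
  -- with `d ≤ k 2^k` the last two conditions follow from `k (3/4)^k → 0` and `k³ (3/5)^k → 0`
  have t1 : ∀ᶠ k : ℕ in atTop, (k : ℝ) ^ 1 * (3 / 4) ^ k ≤ 1 / 32 :=
    (tendsto_pow_const_mul_const_pow_of_abs_lt_one 1
      (by rw [abs_of_pos] <;> norm_num)).eventually_le_const (by norm_num)
  have t2 : ∀ᶠ k : ℕ in atTop, (k : ℝ) ^ 3 * (3 / 5) ^ k ≤ 1 / 32 :=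
    (tendsto_pow_const_mul_const_pow_of_abs_lt_one 3
      (by rw [abs_of_pos] <;> norm_num)).eventually_le_const (by norm_num)
  obtain ⟨k₁, hk₁⟩ := eventually_atTop.1 (t1.and t2)
  refine ⟨max k₁ 60, le_max_of_le_right (by norm_num), fun k hk d hd hdk => ?_⟩
  obtain ⟨h1, h2⟩ := hk₁ k (le_of_max_le_left hk)
  have hk60 : 60 ≤ k := le_of_max_le_right hk
  have hd2 := hdk.trans (satThreshold_le (by omega))
  have h64 : (2 : ℝ) ^ (-6 : ℝ) = 1 / 64 := by
    rw [Real.rpow_neg (by norm_num)]; norm_num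
  refine ⟨?_, ?_, ?_⟩
  · rw [← h64]
    refine Real.rpow_le_rpow_of_exponent_le (by norm_num) ?_
    have : (60 : ℝ) ≤ k := by exact_mod_cast hk60
    linarith
  · have hδ : (4 / 5 : ℝ) ^ k ≤ ((2 : ℝ) ^ (-(k : ℝ) / 10)) ^ 3 := by
      have e1 : ((2 : ℝ) ^ (-(k : ℝ) / 10)) ^ 3 = ((2 : ℝ) ^ (-(3 : ℝ) / 10)) ^ k := by
        rw [← Real.rpow_natCast, ← Real.rpow_natCast, ← Real.rpow_mul (by norm_num),
          ← Real.rpow_mul (by norm_num)]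
        congr 1
        push_cast
        ring
      rw [e1]
      refine pow_le_pow_left₀ (by norm_num) ?_ k
      refine le_of_pow_le_pow_left₀ (n := 10) (by norm_num) (by positivity) ?_
      have e5 : ((2 : ℝ) ^ (-(3 : ℝ) / 10)) ^ 10 = 1 / 8 := by
        have e6 : (2 : ℝ) ^ (-3 : ℝ) = 1 / 8 := by rw [Real.rpow_neg (by norm_num)]; norm_num
        rw [← e6, ← Real.rpow_natCast, ← Real.rpow_mul (by norm_num)]
        norm_num
      rw [e5]
      norm_num
    refine le_trans ?_ hδ
    have e2 : (3 / 10 : ℝ) ^ k = 3 / 10 * (3 / 10) ^ (k - 1) := by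
      rw [← pow_succ']; congr 1; omega
    have e3 : (2 : ℝ) ^ k * (3 / 10) ^ k = (4 / 5) ^ k * (3 / 4) ^ k := by
      rw [← mul_pow, ← mul_pow]; norm_num
    calc 8 * d * (3 / 10) ^ (k - 1) ≤ 8 * (k * 2 ^ k) * (3 / 10) ^ (k - 1) := by gcongr
      _ = (4 / 5) ^ k * (80 / 3 * ((k : ℝ) ^ 1 * (3 / 4) ^ k)) := by
          linear_combination (8 * k * 2 ^ k * (10 / 3) : ℝ) * (-e2) + (80 / 3 * k : ℝ) * e3
      _ ≤ (4 / 5) ^ k * 1 := by gcongr; linarith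
      _ = _ := mul_one _
  · have e2 : (3 / 10 : ℝ) ^ k = (3 / 10) ^ 2 * (3 / 10) ^ (k - 2) := by
      rw [← pow_add]; congr 1; omega
    have e3 : (2 : ℝ) ^ k * (3 / 10) ^ k = (3 / 5) ^ k := by
      rw [← mul_pow]; norm_num
    have e4 : ((k - 1 : ℕ) : ℝ) ≤ k := by exact_mod_cast Nat.sub_le k 1
    calc _ ≤ (k * 2 ^ k : ℝ) * ((k : ℝ) ^ 2 * (3 / 10) ^ (k - 2)) := by gcongr
      _ = 100 / 9 * ((k : ℝ) ^ 3 * (3 / 5) ^ k) := by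
          linear_combination (k ^ 3 * 2 ^ k * (100 / 9) : ℝ) * (-e2) + (100 / 9 * k ^ 3 : ℝ) * e3
      _ ≤ _ := by linarith

/-! ### Iteration and convergence -/

theorem isAdapted_upInit {k : ℕ} : IsAdapted fun ω : Sample k => upInit ω.2 := by
  intro x
  rcases x with _ | ⟨⟨i, j⟩, y⟩
  · exact measurable_subtype_coe.comp (measurable_init (init_mem_subtree _))
  · exact measurable_subtype_coe.comp (measurable_init (init_mem_subtree _))

theorem IsAdapted.upMsg {k : ℕ} {u : Sample k → TVar k → ℝ} (hu : IsAdapted u) (β : ℝ) (t : ℕ) :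
    IsAdapted fun ω => upMsg β ω.1 (u ω) t := by
  induction t with
  | zero => exact hu
  | succ t ih => exact (ih.logOdds β).sigmoid

theorem upMsg_succ' {k : ℕ} (β : ℝ) (τ : TreeData k) (u : TVar k → ℝ) (t : ℕ) :
    upMsg β τ u (t + 1) = upMsg β τ (upMsg β τ u 1) t := by
  induction t with
  | zero => rfl
  | succ t ih =>
    rw [upMsg, ih]
    rfl

theorem upInit_halfInit {k : ℕ} : upInit (halfInit k) = fun _ => 1 / 2 := by
  funext x
  rcases x with _ | ⟨⟨i, j⟩, y⟩ <;> rfl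

theorem abs_sigmoid_sub_half_le (x : ℝ) : |Real.sigmoid x - 1 / 2| ≤ 1 / 4 * |x| := by
  simpa [Real.sigmoid_zero] using abs_sigmoid_sub_le x 0

theorem sq_sigmoid_sub_le (x y : ℝ) : (Real.sigmoid x - Real.sigmoid y) ^ 2 ≤ (x - y) ^ 2 := by
  rw [sq_le_sq]
  exact (abs_sigmoid_sub_le x y).trans (by linarith [abs_nonneg (x - y)])

section Iteration

variable {k : ℕ} {d : ℝ} {π : Measure unitInterval} [IsProbabilityMeasure π]
  {u u' : Sample k → TVar k → ℝ} {β δ : ℝ}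

theorem measure_le_abs_upMsg_sub_half_le (hd : 0 ≤ d) (hβ : 0 ≤ β) (hu : IsAdapted u)
    (hu1 : ∀ ω x, 0 ≤ u ω x ∧ u ω x ≤ 1) (hδ0 : 0 < δ) (hδ : δ ≤ 1 / 64)
    (hs : ∀ x, sampleLaw k d π {ω | δ ≤ |u ω x - 1 / 2|} ≤ ENNReal.ofReal δ)
    (hk : 8 * d * (3 / 10) ^ (k - 1) ≤ δ ^ 3) (t : ℕ) (x : TVar k) :
    sampleLaw k d π {ω | δ ≤ |upMsg β ω.1 (u ω) t x - 1 / 2|} ≤ ENNReal.ofReal δ := by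
  induction t generalizing x with
  | zero => exact hs x
  | succ t ih =>
    refine le_trans (measure_mono fun ω hω => ?_) (measure_le_abs_logOdds_le hd hβ
      (hu.upMsg β t) (fun ω => upMsg_mem (hu1 ω) t) hδ0 hδ ih hk x)
    have h1 : δ ≤ |Real.sigmoid (logOdds β ω.1 (upMsg β ω.1 (u ω) t) x) - 1 / 2| := hω
    have h2 := abs_sigmoid_sub_half_le (logOdds β ω.1 (upMsg β ω.1 (u ω) t) x)
    change δ ≤ |logOdds β ω.1 (upMsg β ω.1 (u ω) t) x|
    linarith [abs_nonneg (logOdds β ω.1 (upMsg β ω.1 (u ω) t) x)]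

/-- The log-odds forget their initial messages at a geometric rate, in mean square. -/
theorem lintegral_sq_logOdds_upMsg_sub_le (hd : 0 ≤ d) (hβ : 0 ≤ β)
    (hu : IsAdapted u) (hu' : IsAdapted u')
    (hu1 : ∀ ω x, 0 ≤ u ω x ∧ u ω x ≤ 1) (hu1' : ∀ ω x, 0 ≤ u' ω x ∧ u' ω x ≤ 1)
    (hδ0 : 0 < δ) (hδ : δ ≤ 1 / 64)
    (hs : ∀ x, sampleLaw k d π {ω | δ ≤ |u ω x - 1 / 2|} ≤ ENNReal.ofReal δ)
    (hs' : ∀ x, sampleLaw k d π {ω | δ ≤ |u' ω x - 1 / 2|} ≤ ENNReal.ofReal δ)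
    (hk : 8 * d * (3 / 10) ^ (k - 1) ≤ δ ^ 3)
    (hk' : d * ((k - 1 : ℕ) ^ 2 * (3 / 10) ^ (k - 2)) ≤ 1 / 2) (t : ℕ) (x : TVar k) :
    ∫⁻ ω, ENNReal.ofReal ((logOdds β ω.1 (upMsg β ω.1 (u ω) t) x -
      logOdds β ω.1 (upMsg β ω.1 (u' ω) t) x) ^ 2) ∂sampleLaw k d π ≤
      ENNReal.ofReal ((1 / 2) ^ t * (d * β ^ 2)) := by
  induction t generalizing x with
  | zero =>
    rw [pow_zero, one_mul, ENNReal.ofReal_mul hd]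
    exact lintegral_sq_logOdds_sub_le_sq hβ hu hu' hu1 hu1' x
  | succ t ih =>
    refine (lintegral_sq_logOdds_sub_le_mul (δ := δ) hβ ((hu.upMsg β t).logOdds β)
      ((hu'.upMsg β t).logOdds β) hδ0.le hδ
      (measure_le_abs_upMsg_sub_half_le hd hβ hu hu1 hδ0 hδ hs hk (t + 1))
      (measure_le_abs_upMsg_sub_half_le hd hβ hu' hu1' hδ0 hδ hs' hk (t + 1)) ih x).trans ?_
    rw [← ENNReal.ofReal_mul (by positivity), ← ENNReal.ofReal_mul hd]
    refine ENNReal.ofReal_le_ofReal ?_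
    calc _ = d * ((k - 1 : ℕ) ^ 2 * (3 / 10) ^ (k - 2)) * ((1 / 2) ^ t * (d * β ^ 2)) := by ring
      _ ≤ 1 / 2 * ((1 / 2) ^ t * (d * β ^ 2)) := by gcongr
      _ = _ := by ring

/-- Young's inequality turns the mean square bound into a bound in mean. -/
theorem lintegral_abs_upMsg_sub_le (hu : IsAdapted u) (hu' : IsAdapted u') {C r : ℝ} (hC : 0 ≤ C)
    (hr : 0 < r) (t : ℕ) (x : TVar k)
    (h : ∫⁻ ω, ENNReal.ofReal ((logOdds β ω.1 (upMsg β ω.1 (u ω) t) x -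
      logOdds β ω.1 (upMsg β ω.1 (u' ω) t) x) ^ 2) ∂sampleLaw k d π ≤ ENNReal.ofReal C) :
    ∫⁻ ω, ENNReal.ofReal |upMsg β ω.1 (u ω) (t + 1) x - upMsg β ω.1 (u' ω) (t + 1) x|
      ∂sampleLaw k d π ≤ ENNReal.ofReal (r / 2 + C / (2 * r)) := by
  set D : Sample k → ℝ := fun ω => logOdds β ω.1 (upMsg β ω.1 (u ω) t) x -
      logOdds β ω.1 (upMsg β ω.1 (u' ω) t) x with hD
  have hDm : Measurable D := (((hu.upMsg β t).logOdds β).measurable x).sub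
    (((hu'.upMsg β t).logOdds β).measurable x)
  calc _ ≤ ∫⁻ ω, (ENNReal.ofReal (r / 2) + ENNReal.ofReal (1 / (2 * r)) *
        ENNReal.ofReal (D ω ^ 2)) ∂sampleLaw k d π := by
        refine lintegral_mono fun ω => ?_
        rw [← ENNReal.ofReal_mul (by positivity), ← ENNReal.ofReal_add (by positivity)
          (by positivity)]
        refine ENNReal.ofReal_le_ofReal ?_
        have h1 := sq_sigmoid_sub_le (logOdds β ω.1 (upMsg β ω.1 (u ω) t) x)
          (logOdds β ω.1 (upMsg β ω.1 (u' ω) t) x)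
        change _ ≤ D ω ^ 2 at h1
        change |Real.sigmoid _ - Real.sigmoid _| ≤ _
        rw [← sq_abs] at h1
        set a := |Real.sigmoid (logOdds β ω.1 (upMsg β ω.1 (u ω) t) x) -
          Real.sigmoid (logOdds β ω.1 (upMsg β ω.1 (u' ω) t) x)|
        have h2 : r / 2 + 1 / (2 * r) * D ω ^ 2 = (r ^ 2 + D ω ^ 2) / (2 * r) := by
          field_simp
        rw [h2, le_div_iff₀ (by positivity)]
        nlinarith [sq_nonneg (a - r)]
    _ = ENNReal.ofReal (r / 2) + ENNReal.ofReal (1 / (2 * r)) *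
        ∫⁻ ω, ENNReal.ofReal (D ω ^ 2) ∂sampleLaw k d π := by
        rw [lintegral_add_left measurable_const, lintegral_const_mul' _ _ ENNReal.ofReal_ne_top]
        simp
    _ ≤ ENNReal.ofReal (r / 2) + ENNReal.ofReal (1 / (2 * r)) * ENNReal.ofReal C := by gcongr
    _ = _ := by
        rw [← ENNReal.ofReal_mul (by positivity), ← ENNReal.ofReal_add (by positivity)
          (by positivity)]
        congr 1
        ring

end Iteration

/-- The event in the definition of slim tails, in terms of the distance to `1/2`. -/
theorem slimTails_iff (k : ℕ) (π : Measure unitInterval) :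
    SlimTails k π ↔ π {p : unitInterval | (2 : ℝ) ^ (-(k : ℝ) / 10) ≤ |(p : ℝ) - 1 / 2|} ≤
      ENNReal.ofReal ((2 : ℝ) ^ (-(k : ℝ) / 10)) := by
  unfold SlimTails
  have : {x : unitInterval | (x : ℝ) ∈ Set.Icc 0 (1 / 2 - (2 : ℝ) ^ (-(k : ℝ) / 10)) ∪
      Set.Icc (1 / 2 + (2 : ℝ) ^ (-(k : ℝ) / 10)) 1} =
      {p : unitInterval | (2 : ℝ) ^ (-(k : ℝ) / 10) ≤ |(p : ℝ) - 1 / 2|} := by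
    ext p
    simp only [Set.mem_ofPred_eq, Set.mem_union, Set.mem_Icc, p.2.1, p.2.2, true_and, and_true,
      le_abs]
    constructor
    · rintro (h | h)
      · right; linarith
      · left; linarith
    · rintro (h | h)
      · right; linarith
      · left; linarith
  rw [this]

theorem measure_upInit_le {k : ℕ} {d : ℝ} {π : Measure unitInterval} [IsProbabilityMeasure π]
    (hπ : SlimTails k π) (x : TVar k) :
    sampleLaw k d π {ω | (2 : ℝ) ^ (-(k : ℝ) / 10) ≤ |upInit ω.2 x - 1 / 2|} ≤
      ENNReal.ofReal ((2 : ℝ) ^ (-(k : ℝ) / 10)) := by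
  rw [slimTails_iff] at hπ
  have key : ∀ p : TVar k × TClause k, sampleLaw k d π {ω | (2 : ℝ) ^ (-(k : ℝ) / 10) ≤
      |(ω.2.2 p : ℝ) - 1 / 2|} ≤ ENNReal.ofReal ((2 : ℝ) ^ (-(k : ℝ) / 10)) := by
    intro p
    rw [← map_init (d := d) (π := π) p, Measure.map_apply (by fun_prop)
      (measurableSet_le measurable_const (by fun_prop))] at hπ
    exact hπ
  rcases x with _ | ⟨⟨i, j⟩, y⟩
  · exact key _
  · exact key _

theorem measurable_upMsg_upInit {k : ℕ} (β : ℝ) (η : InitData k) (t : ℕ) (x : TVar k) :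
    Measurable fun τ : TreeData k => upMsg β τ (upInit η) t x := by
  have h : Measurable fun ω : Sample k => upMsg β ω.1 (upInit ω.2) t x :=
    (isAdapted_upInit.upMsg β t).measurable x
  exact Measurable.of_uncurry_right (f := fun τ η => upMsg β τ (upInit η) t x) (y := η) h

theorem measurable_rootMarginal_succ {k : ℕ} {β : ℝ} (hβ : 0 ≤ β) (η : InitData k) (t : ℕ) :
    Measurable fun τ : TreeData k => rootMarginal β τ η (t + 1) := by
  simp_rw [rootMarginal_succ hβ]
  exact measurable_upMsg_upInit β η (t + 1) []

theorem isAdapted_const {k : ℕ} (c : ℝ) : IsAdapted fun (_ : Sample k) (_ : TVar k) => c :=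
  fun _ => measurable_const

/-- The comparison of the root marginals for two families of initial messages. -/
theorem integral_abs_rootMarginal_sub_le {k : ℕ} {d β : ℝ} (hd : 0 < d) (hβ : 0 ≤ β)
    (hδ : (2 : ℝ) ^ (-(k : ℝ) / 10) ≤ 1 / 64)
    (hk : 8 * d * (3 / 10) ^ (k - 1) ≤ ((2 : ℝ) ^ (-(k : ℝ) / 10)) ^ 3)
    (hk' : d * ((k - 1 : ℕ) ^ 2 * (3 / 10) ^ (k - 2)) ≤ 1 / 2)
    {π : Measure unitInterval} [IsProbabilityMeasure π] (hπ : SlimTails k π) {ε : ℝ} (hε : 0 < ε)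
    {t : ℕ} (ht : (1 / 2) ^ t * (d * β ^ 2) ≤ ε ^ 2) :
    Integrable (fun ω : Sample k => |rootMarginal β ω.1 ω.2 (t + 1) -
      rootMarginal β ω.1 (halfInit k) (t + 1)|) (sampleLaw k d π) ∧
    ∫ ω, |rootMarginal β ω.1 ω.2 (t + 1) - rootMarginal β ω.1 (halfInit k) (t + 1)|
      ∂sampleLaw k d π ≤ ε := by
  simp_rw [rootMarginal_succ hβ, upInit_halfInit]
  have hu := isAdapted_upInit (k := k)
  have hu' := isAdapted_const (k := k) (1 / 2)
  have h1 : ∀ (ω : Sample k) x, 0 ≤ upInit ω.2 x ∧ upInit ω.2 x ≤ 1 := fun ω => upInit_mem _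
  have h1' : ∀ (_ : Sample k) (_ : TVar k), (0 : ℝ) ≤ 1 / 2 ∧ (1 / 2 : ℝ) ≤ 1 := fun _ _ => by
    norm_num
  have hδ0 : 0 < (2 : ℝ) ^ (-(k : ℝ) / 10) := by positivity
  have hs' : ∀ _ : TVar k, sampleLaw k d π {_ω | (2 : ℝ) ^ (-(k : ℝ) / 10) ≤ |(1 / 2 : ℝ) - 1 / 2|}
      ≤ ENNReal.ofReal ((2 : ℝ) ^ (-(k : ℝ) / 10)) := fun _ => by
    simp [not_le.2 hδ0]
  have hb := lintegral_abs_upMsg_sub_le hu hu' (sq_nonneg ε) hε t []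
    ((lintegral_sq_logOdds_upMsg_sub_le hd.le hβ hu hu' h1 h1' hδ0 hδ (measure_upInit_le hπ) hs'
      hk hk' t []).trans (ENNReal.ofReal_le_ofReal ht))
  have hm : Measurable fun ω : Sample k => |upMsg β ω.1 (upInit ω.2) (t + 1) [] -
      upMsg β ω.1 (fun _ => 1 / 2) (t + 1) []| :=
    (((hu.upMsg β _).measurable _).sub ((hu'.upMsg β _).measurable _)).norm
  refine ⟨Integrable.of_bound hm.aestronglyMeasurable 1 (ae_of_all _ fun ω => ?_), ?_⟩
  · rw [Real.norm_eq_abs, abs_abs]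
    have a := upMsg_mem (β := β) (τ := ω.1) (h1 ω) (t + 1) []
    have b := upMsg_mem (β := β) (τ := ω.1) (h1' ω) (t + 1) []
    exact abs_le.2 ⟨by linarith, by linarith⟩
  · rw [integral_eq_lintegral_of_nonneg_ae (ae_of_all _ fun ω => abs_nonneg _)
      hm.aestronglyMeasurable]
    refine (ENNReal.toReal_le_of_le_ofReal (by positivity) hb).trans_eq ?_
    field_simp
    ring

/-- Slim tails pass to weak limits if they hold with half the width: `{|y - 1/2| ≥ δ}` is closed, so
the portmanteau theorem is applied to the open set `{|y - 1/2| > δ/2}` around it. -/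
theorem slimTails_map_of_tendstoInDistribution {k : ℕ} {Ω : Type*} [MeasurableSpace Ω]
    {P : Measure Ω} [IsProbabilityMeasure P] {X : ℕ → Ω → ℝ}
    {π : Measure unitInterval} [IsProbabilityMeasure π]
    (h : TendstoInDistribution X atTop (fun p : unitInterval => (p : ℝ)) (fun _ => P) π)
    (hX : ∀ t, P {ω | (2 : ℝ) ^ (-(k : ℝ) / 10) / 2 < |X t ω - 1 / 2|} ≤
      ENNReal.ofReal ((2 : ℝ) ^ (-(k : ℝ) / 10))) : SlimTails k π := by
  rw [slimTails_iff]
  set δ : ℝ := (2 : ℝ) ^ (-(k : ℝ) / 10) with hδ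
  have hδ0 : 0 < δ := by positivity
  have hG : IsOpen {y : ℝ | δ / 2 < |y - 1 / 2|} := isOpen_lt (by fun_prop) (by fun_prop)
  have h1 := ProbabilityMeasure.le_liminf_measure_open_of_tendsto h.tendsto hG
  simp only [ProbabilityMeasure.coe_mk] at h1
  rw [Measure.map_apply_of_aemeasurable h.aemeasurable_limit hG.measurableSet] at h1
  calc _ ≤ π {p | δ / 2 < |(p : ℝ) - 1 / 2|} := measure_mono fun p (hp : δ ≤ _) => by
        change δ / 2 < _
        linarith
    _ ≤ _ := h1
    _ ≤ liminf (fun _ : ℕ => ENNReal.ofReal δ) atTop := by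
        refine liminf_le_liminf (Eventually.of_forall fun t => ?_)
        rw [Measure.map_apply_of_aemeasurable (h.forall_aemeasurable t) hG.measurableSet]
        exact hX t
    _ = _ := liminf_const _

/-- A sequence of `[0,1]`-valued random variables with summable mean increments converges in
distribution. -/
theorem exists_tendstoInDistribution_of_summable {Ω : Type*} [MeasurableSpace Ω]
    {P : Measure Ω} [IsProbabilityMeasure P] {X : ℕ → Ω → ℝ} (hXm : ∀ t, Measurable (X t))
    (hX : ∀ t ω, 0 ≤ X t ω ∧ X t ω ≤ 1) {c : ℕ → ℝ} (hc : Summable c)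
    (hXc : ∀ t, ∫⁻ ω, ENNReal.ofReal |X (t + 1) ω - X t ω| ∂P ≤ ENNReal.ofReal (c t)) :
    ∃ π : ProbabilityMeasure unitInterval,
      TendstoInDistribution X atTop (fun p : unitInterval => (p : ℝ)) (fun _ => P)
        (π : Measure unitInterval) := by
  let Y : ℕ → Ω → unitInterval := fun t ω => ⟨X t ω, hX t ω⟩
  have hYm : ∀ t, Measurable (Y t) := fun t => (hXm t).subtype_mk
  have hem : ∀ t, Measurable fun ω => ENNReal.ofReal |X (t + 1) ω - X t ω| := fun t =>
    ENNReal.measurable_ofReal.comp ((hXm _).sub (hXm _)).norm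
  have hsum : ∫⁻ ω, ∑' t, ENNReal.ofReal |X (t + 1) ω - X t ω| ∂P ≠ ∞ := by
    rw [lintegral_tsum fun t => (hem t).aemeasurable]
    refine ne_top_of_le_ne_top (hc.tsum_ofReal_ne_top) (ENNReal.tsum_le_tsum hXc)
  have hlim : ∀ᵐ ω ∂P, ∃ l, Tendsto (fun t => Y t ω) atTop (𝓝 l) := by
    filter_upwards [ae_lt_top (Measurable.tsum hem) hsum] with ω hω
    refine cauchySeq_tendsto_of_complete (cauchySeq_of_edist_le_of_tsum_ne_top _ (fun t => ?_)
      hω.ne)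
    rw [edist_comm, Subtype.edist_eq, edist_dist, Real.dist_eq]
  obtain ⟨Z, hZ, hYZ⟩ := measurable_limit_of_tendsto_metrizable_ae
    (fun t => (hYm t).aemeasurable) hlim
  have hdist : TendstoInDistribution X atTop (fun ω => (Z ω : ℝ)) (fun _ => P) P := by
    refine tendstoInDistribution_of_ae_tendsto (fun t => (hXm t).aemeasurable)
      (by fun_prop) ?_
    filter_upwards [hYZ] with ω hω
    exact (continuous_subtype_val.tendsto _).comp hω
  let π : ProbabilityMeasure unitInterval :=
    ⟨P.map Z, Measure.isProbabilityMeasure_map hZ.aemeasurable⟩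
  refine ⟨π, hdist.forall_aemeasurable, by fun_prop, ?_⟩
  convert hdist.tendsto using 2
  exact congrArg 𝓝 (Subtype.ext (Measure.map_map measurable_subtype_coe hZ))

/-- The root marginals started from `1/2` converge in distribution, to a limit with slim tails. -/
theorem exists_limit_rootMarginal {k : ℕ} {d β : ℝ} (hd : 0 < d) (hβ : 0 ≤ β)
    (hδ : (2 : ℝ) ^ (-(k : ℝ) / 10) ≤ 1 / 64)
    (hk : 8 * d * (3 / 10) ^ (k - 1) ≤ ((2 : ℝ) ^ (-(k : ℝ) / 10)) ^ 3)
    (hk' : d * ((k - 1 : ℕ) ^ 2 * (3 / 10) ^ (k - 2)) ≤ 1 / 2) :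
    ∃ πstar : ProbabilityMeasure unitInterval,
      SlimTails k (πstar : Measure unitInterval) ∧
      TendstoInDistribution
        (fun (t : ℕ) (τ : TreeData k) => rootMarginal β τ (halfInit k) (t + 1))
        atTop (fun p : unitInterval => (p : ℝ))
        (fun _ => treeLaw k d) (πstar : Measure unitInterval) := by
  -- the law of the initial messages plays no role here
  let π : Measure unitInterval := Measure.dirac 0
  have hfst : MeasurePreserving Prod.fst (sampleLaw k d π) (treeLaw k d) := measurePreserving_fst
  set δ : ℝ := (2 : ℝ) ^ (-(k : ℝ) / 10)
  have hδ0 : 0 < δ := by positivity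
  have hrm : ∀ t, Measurable fun τ : TreeData k => rootMarginal β τ (halfInit k) (t + 1) :=
    measurable_rootMarginal_succ hβ (halfInit k)
  have hroot : ∀ (τ : TreeData k) t, rootMarginal β τ (halfInit k) (t + 1) =
      upMsg β τ (fun _ => 1 / 2) (t + 1) [] := fun τ t => by
    rw [rootMarginal_succ hβ, upInit_halfInit]
  have h1 : ∀ (_ : Sample k) (_ : TVar k), (0 : ℝ) ≤ 1 / 2 ∧ (1 / 2 : ℝ) ≤ 1 := fun _ _ => by
    norm_num
  have hu := isAdapted_const (k := k) (1 / 2)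
  have hu' := hu.upMsg β 1
  have h1' : ∀ (ω : Sample k) x, 0 ≤ upMsg β ω.1 (fun _ => 1 / 2) 1 x ∧
      upMsg β ω.1 (fun _ => 1 / 2) 1 x ≤ 1 := fun ω => upMsg_mem (h1 ω) 1
  have hs : ∀ _ : TVar k, sampleLaw k d π {_ω | δ ≤ |(1 / 2 : ℝ) - 1 / 2|}
      ≤ ENNReal.ofReal δ := fun _ => by
    simp [not_le.2 hδ0]
  have hs' := measure_le_abs_upMsg_sub_half_le hd.le hβ hu h1 hδ0 hδ hs hk
  have hincr : ∀ t, ∫⁻ τ, ENNReal.ofReal |rootMarginal β τ (halfInit k) (t + 1 + 1) -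
      rootMarginal β τ (halfInit k) (t + 1)| ∂treeLaw k d ≤
      ENNReal.ofReal ((3 / 4) ^ t / 2 + (1 / 2) ^ t * (d * β ^ 2) / (2 * (3 / 4) ^ t)) := by
    intro t
    -- `upMsg (t + 1)` is `upMsg t` started from the messages after one round; the parameter
    -- `(3/4)^t` makes both resulting geometric series converge
    have h := lintegral_abs_upMsg_sub_le hu' hu (C := (1 / 2) ^ t * (d * β ^ 2)) (by positivity)
      (r := (3 / 4) ^ t) (by positivity) t []
      (lintegral_sq_logOdds_upMsg_sub_le hd.le hβ hu' hu h1' h1 hδ0 hδ (hs' 1) hs hk hk' t [])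
    rw [← hfst.lintegral_comp]
    · simp_rw [hroot]
      simp_rw [← upMsg_succ'] at h
      exact h
    · exact ENNReal.measurable_ofReal.comp ((hrm _).sub (hrm _)).norm
  have hsumm : Summable fun t : ℕ =>
      (3 / 4 : ℝ) ^ t / 2 + (1 / 2) ^ t * (d * β ^ 2) / (2 * (3 / 4) ^ t) := by
    have e : ∀ t : ℕ, (3 / 4 : ℝ) ^ t / 2 + (1 / 2) ^ t * (d * β ^ 2) / (2 * (3 / 4) ^ t) =
        1 / 2 * (3 / 4) ^ t + d * β ^ 2 / 2 * (2 / 3) ^ t := fun t => by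
      have e1 : (2 / 3 : ℝ) ^ t * (3 / 4) ^ t = (1 / 2) ^ t := by rw [← mul_pow]; norm_num
      rw [← e1]
      field_simp
    simp_rw [e]
    exact ((summable_geometric_of_lt_one (by norm_num) (by norm_num)).mul_left _).add
      ((summable_geometric_of_lt_one (by norm_num) (by norm_num)).mul_left _)
  obtain ⟨πstar, hstar⟩ := exists_tendstoInDistribution_of_summable hrm
    (fun t τ => by rw [hroot]; exact upMsg_mem (fun _ => by norm_num) _ _)
    hsumm hincr
  refine ⟨πstar, slimTails_map_of_tendstoInDistribution hstar fun t => ?_, hstar⟩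
  have hmeas : MeasurableSet {τ : TreeData k |
      δ / 2 < |rootMarginal β τ (halfInit k) (t + 1) - 1 / 2|} :=
    measurableSet_lt measurable_const ((hrm t).sub_const _).norm
  rw [← hfst.measure_preimage hmeas.nullMeasurableSet]
  refine le_trans (measure_mono fun ω hω => ?_) (measure_le_abs_logOdds_le hd.le hβ
    (hu.upMsg β t) (fun ω => upMsg_mem (h1 ω) t) hδ0 hδ (hs' t) hk [])
  have h2 : δ / 2 < |rootMarginal β ω.1 (halfInit k) (t + 1) - 1 / 2| := hω
  rw [hroot] at h2
  have h3 := abs_sigmoid_sub_half_le (logOdds β ω.1 (upMsg β ω.1 (fun _ => 1 / 2) t) [])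
  change δ / 2 < |Real.sigmoid _ - 1 / 2| at h2
  change δ ≤ |logOdds β ω.1 (upMsg β ω.1 (fun _ => 1 / 2) t) []|
  linarith

end BPkSAT

end

theorem proposition2p3 :
    ∃ k₀ : ℕ, 3 ≤ k₀ ∧ ∀ k : ℕ, k₀ ≤ k → ∀ d : ℝ, 0 < d → d ≤ satThreshold k →
      ∀ β : ℝ, 1 ≤ β →
        (∀ ε : ℝ, 0 < ε → ∃ t₀ : ℕ, ∀ t : ℕ, t₀ ≤ t →
          ∀ π : ProbabilityMeasure unitInterval, SlimTails k (π : Measure unitInterval) →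
            Integrable
              (fun ω : TreeData k × InitData k =>
                |rootMarginal β ω.1 ω.2 t - rootMarginal β ω.1 (halfInit k) t|)
              ((treeLaw k d).prod (initLaw k (π : Measure unitInterval))) ∧
            ∫ ω : TreeData k × InitData k,
                |rootMarginal β ω.1 ω.2 t - rootMarginal β ω.1 (halfInit k) t|
              ∂((treeLaw k d).prod (initLaw k (π : Measure unitInterval))) ≤ ε) ∧
        ∃ πstar : ProbabilityMeasure unitInterval,
          SlimTails k (πstar : Measure unitInterval) ∧
          TendstoInDistribution
            (fun (t : ℕ) (τ : TreeData k) => rootMarginal β τ (halfInit k) (t + 1))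
            atTop (fun p : unitInterval => (p : ℝ))
            (fun _ => treeLaw k d) (πstar : Measure unitInterval) := by
  obtain ⟨k₀, hk₀, h⟩ := exists_large_k
  refine ⟨k₀, hk₀, fun k hk d hd hdk β hβ => ?_⟩
  obtain ⟨hδ, hk1, hk2⟩ := h k hk d hd hdk
  have hβ0 : 0 ≤ β := zero_le_one.trans hβ
  refine ⟨fun ε hε => ?_, exists_limit_rootMarginal hd hβ0 hδ hk1 hk2⟩
  have hlim : Tendsto (fun t : ℕ => (1 / 2 : ℝ) ^ t * (d * β ^ 2)) atTop (𝓝 0) := by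
    simpa using (tendsto_pow_atTop_nhds_zero_of_lt_one (r := (1 / 2 : ℝ)) (by norm_num)
      (by norm_num)).mul_const (d * β ^ 2)
  obtain ⟨s, hs⟩ := eventually_atTop.1 (hlim.eventually_le_const (pow_pos hε 2))
  refine ⟨s + 1, fun t ht π hπ => ?_⟩
  obtain ⟨t, rfl⟩ := Nat.exists_eq_add_of_le' (Nat.le_of_add_left_le ht)
  exact integral_abs_rootMarginal_sub_le hd hβ0 hδ hk1 hk2 hπ hε (hs t (by omega))
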